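/- **Setting.** Let $d\ge 0$ and let $A\in\mathbb R^{d\times d}$ be symmetric. For $\epsilon\in(0,1)$ call $A$ *$\epsilon$-far from PSD* if $A\neq 0$ and $\lambda_{\min}(A)\le-\epsilon\|A\|_F$. A *non-adaptive vector-matrix-vector algorithm* chooses, from its random seed alone, pairs $(v_i,w_i)$ of vectors in $\mathbb R^d$, receives the values $v_i^TAw_i$, and outputs True or False; its number of queries is the number of pairs. It is a *two-sided $(\epsilon,\ell_2)$-tester correct with probability $0.9$* if, for every symmetric $A$, it outputs True with probability at least $0.9$ when $A$ is PSD, and outputs False with probability at least $0.9$ when $A$ is $\epsilon$-far from PSD (errors on both sides are allowed). **The test.** Let $G\in\mathbb R^{d\times k}$ and $H\in\mathbb R^{d\times m}$ have independent $\mathcal N(0,1)$ entries (all entries of $[G\mid H]$ are independent), and let $\alpha$ and $\beta$ be given by measurable real-valued functions of $H^TAH$. If $G^TAG$ is not PSD, output False. Otherwise put $$\gamma=\frac{\alpha-\lambda_{\min}(G^TAG)}{\beta\sqrt k\,\log k}$$ ($\gamma=0$ if the denominator is $0$), and output True if and only if $\gamma\le c_{\mathrm{psd}}$. This test depends on $A$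 only through the sketch $[G\mid H]^TA[G\mid H]$, whose $(k+m)^2$ entries are non-adaptive vector-matrix-vector queries. **Theorem.** There are absolute constants $m\in\mathbb N$ and $c_{\mathrm{psd}},C>0$ and measurable functions $\alpha=\alpha(H^TAH)$, $\beta=\beta(H^TAH)$, none of them depending on $\epsilon$, $d$ or $A$, such that: 1. for every $d$ and every symmetric $A\in\mathbb R^{d\times d}$, each of the events $|\alpha-\mathrm{Tr}(A)|\le\|A\|_F$ and $\tfrac12\|A\|_F\le\beta\le 2\|A\|_F$ has probability at least $0.99$; 2. for every $\epsilon\in(0,1)$ there is an integer $k\ge1$, depending only on $\epsilon$, with $k+m\le C\epsilon^{-2}\log^2(2/\epsilon)$, such that for every $d$ the test above is a two-sided $(\epsilon,\ell_2)$-tester correct with probability $0.9$, and its number of non-adaptive vector-matrix-vector queries is at most $C\epsilon^{-4}\log^4(2/\epsilon)=\widetilde O(1/\epsilon^4)$. -/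

import Mathlib

open MeasureTheory ProbabilityTheory

noncomputable section

namespace PSDTesting

/-- The smallest eigenvalue of a (symmetric) real matrix of positive size. For such a matrix the
spectrum is a finite nonempty set of reals, so the infimum is a minimum. -/
def lambdaMin {ι : Type} [Fintype ι] [DecidableEq ι] (M : Matrix ι ι ℝ) : ℝ :=
  sInf (spectrum ℝ M)

/-- The Frobenius norm `‖M‖_F`, that is, the Schatten 2-norm. -/
def frobNorm {ι κ : Type} [Fintype ι] [Fintype κ] (M : Matrix ι κ ℝ) : ℝ :=
  Real.sqrt (∑ i, ∑ j, M i j ^ 2)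

/-- `A` is `ε‖A‖_F`-far from the PSD cone: `λ_min(A) ≤ -ε ‖A‖_F`. The zero matrix, which is PSD
but satisfies this inequality as an equality, is not counted as far. -/
def IsFarFromPSD {d : ℕ} (ε : ℝ) (A : Matrix (Fin d) (Fin d) ℝ) : Prop :=
  A ≠ 0 ∧ lambdaMin A ≤ -(ε * frobNorm A)

/-- A randomized non-adaptive algorithm in the vector-matrix-vector query model for `d × d`
matrices, with queries indexed by `ι`. It draws a seed `ω`; the seed alone fixes all query pairs
`(left i ω, right i ω)`; the answer to query `i` is `(left i ω)ᵀ A (right i ω)`; the algorithm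
outputs True when `accept` holds of the seed and the list of answers, and False otherwise. -/
structure NonadaptiveVMV (d : ℕ) (ι : Type) where
  Ω : Type
  [measurableSpace : MeasurableSpace Ω]
  μ : Measure Ω
  [isProb : IsProbabilityMeasure μ]
  left : ι → Ω → (Fin d → ℝ)
  right : ι → Ω → (Fin d → ℝ)
  measurable_left : ∀ i, Measurable (left i)
  measurable_right : ∀ i, Measurable (right i)
  accept : Ω → (ι → ℝ) → Prop

namespace NonadaptiveVMV

variable {d : ℕ} {ι : Type}

/-- The answers to the queries on the input `A` with seed `ω`. -/
def answers (T : NonadaptiveVMV d ι) (A : Matrix (Fin d) (Fin d) ℝ) (ω : T.Ω) : ι → ℝ :=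
  fun i => dotProduct (T.left i ω) (A.mulVec (T.right i ω))

/-- The event that the algorithm outputs True on the input `A`; its complement is the event that
it outputs False. -/
def outputsTrue (T : NonadaptiveVMV d ι) (A : Matrix (Fin d) (Fin d) ℝ) : Set T.Ω :=
  {ω | T.accept ω (T.answers A ω)}

/-- The number of vector-matrix-vector queries. -/
def numQueries [Fintype ι] (_T : NonadaptiveVMV d ι) : ℕ := Fintype.card ι

/-- `T` is a (two-sided) `(ε, ℓ₂)`-tester which is correct with probability at least `p`: on every
PSD input it outputs True, and on every input that is `ε`-far from PSD it outputs False, with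
probability at least `p`. Errors on both sides are allowed. -/
def IsL2Tester (T : NonadaptiveVMV d ι) (ε p : ℝ) : Prop :=
  letI := T.measurableSpace
  ∀ A : Matrix (Fin d) (Fin d) ℝ, A.IsSymm →
    MeasurableSet (T.outputsTrue A) ∧
    (A.PosSemidef → p ≤ T.μ.real (T.outputsTrue A)) ∧
    (IsFarFromPSD ε A → p ≤ T.μ.real (T.outputsTrue A)ᶜ)

end NonadaptiveVMV

/-- The Borel (product) sigma-algebra on real matrices. -/
instance instMeasurableSpaceRealMatrix (ι κ : Type) : MeasurableSpace (Matrix ι κ ℝ) :=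
  inferInstanceAs (MeasurableSpace (ι → κ → ℝ))

/-- The law of a random `d × κ` matrix with independent `N(0,1)` entries. -/
def gaussianMatrix (d : ℕ) (κ : Type) [Fintype κ] : Measure (Matrix (Fin d) κ ℝ) :=
  Measure.pi fun _ : Fin d => Measure.pi fun _ : κ => gaussianReal 0 1

instance instIsProbGaussianMatrix (d : ℕ) (κ : Type) [Fintype κ] :
    IsProbabilityMeasure (gaussianMatrix d κ) := by
  unfold gaussianMatrix
  exact inferInstanceAs (IsProbabilityMeasure
    (Measure.pi fun _ : Fin d => Measure.pi fun _ : κ => gaussianReal 0 1))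

/-- The bilinear sketch `Gᵀ A G`. -/
def bilinearSketch {d : ℕ} {κ : Type} (A : Matrix (Fin d) (Fin d) ℝ) (G : Matrix (Fin d) κ ℝ) :
    Matrix κ κ ℝ :=
  G.transpose * A * G

/-- The statistic `γ = (α - λ_min(S)) / (β √k log k)` of a `k × k` sketch `S`, for an estimate `α`
of the trace and an estimate `β` of the Frobenius norm of the input. (It is `0` when `β = 0`.) -/
def gammaStat {k : ℕ} (α β : ℝ) (S : Matrix (Fin k) (Fin k) ℝ) : ℝ :=
  (α - lambdaMin S) / (β * Real.sqrt k * Real.log k)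

/-- The decision rule, as a function of the bilinear sketch `S = Xᵀ A X` of the input `A` with a
matrix `X = [G | H]` of `k + m` columns, so that `S.toBlocks₁₁ = Gᵀ A G` and
`S.toBlocks₂₂ = Hᵀ A H`. The `m` columns of `H` serve to compute the estimates `α = trEst (Hᵀ A H)`
and `β = frEst (Hᵀ A H)`. The output is True if and only if `Gᵀ A G` is PSD and `γ ≤ c`. -/
def sketchAccepts {k m : ℕ} (trEst frEst : Matrix (Fin m) (Fin m) ℝ → ℝ) (c : ℝ)
    (S : Matrix (Fin k ⊕ Fin m) (Fin k ⊕ Fin m) ℝ) : Prop :=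
  S.toBlocks₁₁.PosSemidef ∧
    gammaStat (trEst S.toBlocks₂₂) (frEst S.toBlocks₂₂) S.toBlocks₁₁ ≤ c

/-- The Gaussian bilinear sketch as a non-adaptive algorithm: the seed is a Gaussian
`d × (k + m)` matrix `X`, the query with index `(i, j)` is the pair (column `i`, column `j`) of
`X`, so that the answers are precisely the entries of `Xᵀ A X`, and the decision depends only
on them. -/
def sketchTester (d k m : ℕ) (trEst frEst : Matrix (Fin m) (Fin m) ℝ → ℝ) (c : ℝ) :
    NonadaptiveVMV d ((Fin k ⊕ Fin m) × (Fin k ⊕ Fin m)) where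
  Ω := Matrix (Fin d) (Fin k ⊕ Fin m) ℝ
  μ := gaussianMatrix d (Fin k ⊕ Fin m)
  left q X := fun r => X r q.1
  right q X := fun r => X r q.2
  measurable_left q :=
    measurable_pi_lambda _ fun r => (measurable_pi_apply q.1).comp (measurable_pi_apply r)
  measurable_right q :=
    measurable_pi_lambda _ fun r => (measurable_pi_apply q.2).comp (measurable_pi_apply r)
  accept _ a := sketchAccepts trEst frEst c (Matrix.of fun i j => a (i, j))

/-- The answers that the sketch tester receives form the bilinear sketch. -/
theorem sketchTester_outputsTrue (d k m : ℕ) (trEst frEst : Matrix (Fin m) (Fin m) ℝ → ℝ) (c : ℝ)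
    (A : Matrix (Fin d) (Fin d) ℝ) :
    (sketchTester d k m trEst frEst c).outputsTrue A =
      {X : Matrix (Fin d) (Fin k ⊕ Fin m) ℝ |
        sketchAccepts trEst frEst c (bilinearSketch A X)} := by
  have h : ∀ X : Matrix (Fin d) (Fin k ⊕ Fin m) ℝ,
      (Matrix.of fun i j => (sketchTester d k m trEst frEst c).answers A X (i, j)) =
        bilinearSketch A X := by
    intro X
    ext i j
    simp only [NonadaptiveVMV.answers, sketchTester, bilinearSketch, Matrix.of_apply,
      Matrix.mul_assoc]
    simp only [Matrix.mul_apply, dotProduct, Matrix.mulVec, Matrix.transpose_apply]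
  ext X
  change sketchAccepts trEst frEst c _ ↔ _
  rw [h X]
  rfl

end PSDTesting

end

/-!
By rotation invariance of `G` one may take `A = diag(a₁, …, a_d)`, so that `GᵀAG = ∑ r, aᵣ gᵣ gᵣᵀ`
with independent standard Gaussian rows `gᵣ`.

If `A` is PSD, a Chernoff bound for the weighted chi-square variable `∑ r, aᵣ ⟨gᵣ, y⟩²` shows that
it is unlikely to fall below `Tr A ‖y‖²` by more than a multiple of `√k log k ‖A‖_F`. A union bound
over a finite grid in the unit ball of `ℝᵏ`, together with a second-moment bound on the Frobenius
norm of `Tr A • 1 - GᵀAG` that controls the passage from the grid to the ball, gives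
`λ_min(GᵀAG) ≥ Tr A - O(√k log k) ‖A‖_F`.

If `aᵢ ≤ -ε ‖A‖_F` for some `i`, the row `gᵢ` is itself a test vector: `‖gᵢ‖²` is about `k`, the
term with `r = i` contributes `aᵢ ‖gᵢ‖⁴`, and conditionally on `gᵢ` the other terms concentrate by
Chebyshev's inequality, so `λ_min(GᵀAG) ≤ Tr A - Ω(ε k) ‖A‖_F`.

For `k` of order `ε⁻² log²(2/ε)` the second deviation dominates the first one. The trace and the
Frobenius norm are estimated by averaging diagonal entries and squares of disjoint off-diagonal
entries of `HᵀAH`.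
-/

namespace PSDTesting

open scoped NNReal ENNReal Matrix

section Events

variable {Ω Ω' : Type*} [MeasurableSpace Ω] [MeasurableSpace Ω'] {μ : Measure Ω}

theorem measureReal_preimage_le {ν : Measure Ω'} [IsFiniteMeasure ν] {f : Ω → Ω'}
    (hf : MeasurePreserving f μ ν) (s : Set Ω') : μ.real (f ⁻¹' s) ≤ ν.real s :=
  ENNReal.toReal_mono (measure_ne_top ν s) (hf.measure_preimage_le s)

theorem le_measureReal_of_notMem [IsProbabilityMeasure μ] {bad good : Set Ω} {δ p : ℝ}
    (hbad : μ.real bad ≤ δ) (hp : p ≤ 1 - δ) (hgood : ∀ ω ∉ bad, ω ∈ good) : p ≤ μ.real good := by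
  have cover : μ.real (good ∪ bad) = 1 := by
    rw [Set.eq_univ_of_forall (s := good ∪ bad) fun ω => or_iff_not_imp_right.2 (hgood ω),
      probReal_univ]
  linarith [measureReal_union_le (μ := μ) good bad]

end Events

section GaussianMoments

theorem iteratedDeriv_add_two_exp_sq (v : ℝ) (n : ℕ) (t : ℝ) :
    iteratedDeriv (n + 2) (fun t : ℝ => Real.exp (v * t ^ 2 / 2)) t =
      v * t * iteratedDeriv (n + 1) (fun t : ℝ => Real.exp (v * t ^ 2 / 2)) t +
        (n + 1) * v * iteratedDeriv n (fun t : ℝ => Real.exp (v * t ^ 2 / 2)) t := by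
  set f : ℝ → ℝ := fun t => Real.exp (v * t ^ 2 / 2)
  have smooth : ContDiff ℝ ⊤ f := by fun_prop
  have hasDeriv (j : ℕ) (t : ℝ) :
      HasDerivAt (iteratedDeriv j f) (iteratedDeriv (j + 1) f t) t := by
    rw [iteratedDeriv_succ]
    exact ((smooth.differentiable_iteratedDeriv j (WithTop.coe_lt_top _)) t).hasDerivAt
  have first : iteratedDeriv 1 f = fun t => v * t * f t := by
    funext t
    rw [iteratedDeriv_one, (((hasDerivAt_pow 2 t).const_mul v).div_const 2).exp.deriv]
    ring
  have linear (t : ℝ) : HasDerivAt (fun t => v * t) v t := by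
    simpa using (hasDerivAt_id t).const_mul v
  induction n generalizing t with
  | zero =>
    have second := ((linear t).fun_mul (hasDeriv 0 t)).deriv
    simp only [iteratedDeriv_zero] at second
    simp only [zero_add, iteratedDeriv_succ (n := 1), first, second, iteratedDeriv_zero]
    push_cast
    ring
  | succ n ih =>
    have next := (((linear t).fun_mul (hasDeriv (n + 1) t)).fun_add
      ((hasDeriv n t).const_mul ((n + 1) * v))).deriv
    rw [← funext ih, ← iteratedDeriv_succ] at next
    rw [next]
    push_cast
    ring

theorem integral_pow_gaussianReal (v : ℝ≥0) (n : ℕ) :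
    ∫ x, x ^ n ∂(gaussianReal 0 v) =
      iteratedDeriv n (fun t : ℝ => Real.exp (v * t ^ 2 / 2)) 0 := by
  have h := iteratedDeriv_mgf_zero (X := id) (μ := gaussianReal 0 v)
    (by rw [integrableExpSet_id_gaussianReal]; simp) n
  rw [mgf_id_gaussianReal] at h
  simpa using h.symm

theorem integral_pow_add_two_gaussianReal (v : ℝ≥0) (n : ℕ) :
    ∫ x, x ^ (n + 2) ∂(gaussianReal 0 v) = (n + 1) * v * ∫ x, x ^ n ∂(gaussianReal 0 v) := by
  simp only [integral_pow_gaussianReal, iteratedDeriv_add_two_exp_sq, mul_zero, zero_mul, zero_add]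

theorem integral_sq_gaussianReal (v : ℝ≥0) : ∫ x, x ^ 2 ∂(gaussianReal 0 v) = v := by
  simpa using integral_pow_add_two_gaussianReal v 0

theorem integral_pow_four_gaussianReal (v : ℝ≥0) :
    ∫ x, x ^ 4 ∂(gaussianReal 0 v) = 3 * (v : ℝ) ^ 2 := by
  rw [integral_pow_add_two_gaussianReal v 2, integral_sq_gaussianReal]
  push_cast
  ring

theorem integrable_pow_gaussianReal (v : ℝ≥0) (n : ℕ) :
    Integrable (fun x => x ^ n) (gaussianReal 0 v) :=
  integrable_pow_of_mem_interior_integrableExpSet (X := id)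
    (by rw [integrableExpSet_id_gaussianReal]; simp) n

theorem memLp_sq_gaussianReal (v : ℝ≥0) : MemLp (fun x => x ^ 2) 2 (gaussianReal 0 v) := by
  rw [memLp_two_iff_integrable_sq (by fun_prop)]
  simpa only [← pow_mul] using integrable_pow_gaussianReal v 4

theorem variance_sq_gaussianReal (v : ℝ≥0) :
    Var[fun x => x ^ 2; gaussianReal 0 v] = 2 * (v : ℝ) ^ 2 := by
  rw [variance_eq_sub (memLp_sq_gaussianReal v)]
  simp only [Pi.pow_apply, ← pow_mul, Nat.reduceMul]
  rw [integral_pow_four_gaussianReal, integral_sq_gaussianReal]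
  ring

end GaussianMoments

section WeightedSums

variable {E ι : Type*} [MeasurableSpace E] {ν : Measure E} [IsProbabilityMeasure ν] {f : E → ℝ}
  [Fintype ι]

theorem memLp_weightedSum_pi {p : ℝ≥0∞} (hf : MemLp f p ν) (a : ι → ℝ) :
    MemLp (fun X : ι → E => ∑ r, a r * f (X r)) p (Measure.pi fun _ : ι => ν) :=
  memLp_finsetSum _ fun r _ =>
    (hf.comp_measurePreserving (measurePreserving_eval (fun _ : ι => ν) r)).const_mul (a r)

theorem integral_weightedSum_pi (hf : Integrable f ν) (a : ι → ℝ) :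
    ∫ X, ∑ r, a r * f (X r) ∂(Measure.pi fun _ : ι => ν) = (∑ r, a r) * ∫ x, f x ∂ν := by
  rw [integral_finsetSum _ fun r _ => (integrable_comp_eval hf).const_mul (a r), Finset.sum_mul]
  refine Finset.sum_congr rfl fun r _ => ?_
  rw [integral_const_mul, integral_comp_eval hf.aestronglyMeasurable]

theorem variance_weightedSum_pi (hf : MemLp f 2 ν) (a : ι → ℝ) :
    Var[fun X : ι → E => ∑ r, a r * f (X r); Measure.pi fun _ : ι => ν] =
      (∑ r, a r ^ 2) * Var[f; ν] := by
  have h := variance_sum_pi (μ := fun _ : ι => ν) (X := fun r x => a r * f x)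
    fun r => hf.const_mul (a r)
  rw [show (fun X : ι → E => ∑ r, a r * f (X r)) = ∑ r, fun X : ι → E => a r * f (X r) by
    funext X; simp only [Finset.sum_apply], h, Finset.sum_mul]
  exact Finset.sum_congr rfl fun r _ => variance_const_mul _ _ _

end WeightedSums

section TailBounds

variable {Ω : Type*} [MeasurableSpace Ω] {μ : Measure Ω} [IsProbabilityMeasure μ]

theorem measureReal_lt_abs_sub_integral_le {X : Ω → ℝ} (hX : MemLp X 2 μ)
    {c t : ℝ} (hc : 0 ≤ c) (ht : 0 ≤ t) (hvar : Var[X; μ] ≤ c * t ^ 2) :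
    μ.real {ω | t < |X ω - ∫ ω', X ω' ∂μ|} ≤ c := by
  rcases ht.eq_or_lt with rfl | ht
  · have ae_eq := ae_eq_integral_of_variance_eq_zero hX
      (le_antisymm (by simpa using hvar) (variance_nonneg X μ))
    have null : μ {ω | 0 < |X ω - ∫ ω', X ω' ∂μ|} = 0 := by
      rw [← compl_mem_ae_iff]
      filter_upwards [ae_eq] with ω hω
      simp [hω]
    rwa [measureReal_def, null, ENNReal.toReal_zero]
  · refine (measureReal_mono fun ω (hω : t < _) => hω.le).trans ?_
    refine ENNReal.toReal_le_of_le_ofReal hc ((meas_ge_le_variance_div_sq hX ht).trans ?_)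
    exact ENNReal.ofReal_le_ofReal ((div_le_iff₀ (by positivity)).2 hvar)

end TailBounds

section StandardGaussianVectors

variable {κ : Type*} [Fintype κ]

/-- The standard Gaussian law on `κ → ℝ`, the law of a row of a `gaussianMatrix`. -/
noncomputable abbrev stdPi (κ : Type*) [Fintype κ] : Measure (κ → ℝ) :=
  Measure.pi fun _ : κ => gaussianReal 0 1

theorem dotProduct_self_nonneg (y : κ → ℝ) : 0 ≤ y ⬝ᵥ y :=
  Finset.sum_nonneg fun j _ => mul_self_nonneg (y j)

theorem measurable_dotProduct_right (y : κ → ℝ) : Measurable fun g : κ → ℝ => g ⬝ᵥ y := by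
  unfold dotProduct
  fun_prop

theorem measurePreserving_dotProduct (y : κ → ℝ) :
    MeasurePreserving (· ⬝ᵥ y) (stdPi κ) (gaussianReal 0 (y ⬝ᵥ y).toNNReal) := by
  refine ⟨measurable_dotProduct_right y, ?_⟩
  have coord (j : κ) : HasGaussianLaw (fun g : κ → ℝ => g j) (stdPi κ) :=
    ⟨by
      rw [(measurePreserving_eval (fun _ : κ => gaussianReal 0 1) j).map_eq]
      infer_instance⟩
  have gaussian : HasGaussianLaw (fun g : κ → ℝ => ∑ j, y j * g j) (stdPi κ) :=
    (iIndepFun_pi (X := fun j x => y j * x) fun j => by fun_prop).hasGaussianLaw_fun_sum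
      fun j => (coord j).fun_smul (y j)
  have comm (g : κ → ℝ) : g ⬝ᵥ y = ∑ j, y j * g j := dotProduct_comm g y
  have mean : ∫ g, ∑ j, y j * g j ∂(stdPi κ) = 0 := by
    rw [integral_weightedSum_pi (f := fun x => x) ((memLp_id_gaussianReal 1).integrable le_rfl)]
    simp
  have variance : Var[fun g => ∑ j, y j * g j; stdPi κ] = y ⬝ᵥ y := by
    rw [variance_weightedSum_pi (f := fun x => x) (memLp_id_gaussianReal 2)]
    simp [dotProduct, sq]
  rw [funext comm, gaussian.map_eq_gaussianReal, mean, variance]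

theorem integrable_dotProduct_pow (y : κ → ℝ) (n : ℕ) :
    Integrable (fun g => (g ⬝ᵥ y) ^ n) (stdPi κ) :=
  (measurePreserving_dotProduct y).integrable_comp_of_integrable (integrable_pow_gaussianReal _ n)

theorem integral_dotProduct_pow (y : κ → ℝ) (n : ℕ) :
    ∫ g, (g ⬝ᵥ y) ^ n ∂(stdPi κ) = ∫ x, x ^ n ∂(gaussianReal 0 (y ⬝ᵥ y).toNNReal) := by
  rw [← (measurePreserving_dotProduct y).map_eq,
    integral_map (measurable_dotProduct_right y).aemeasurable (by fun_prop)]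

theorem integral_dotProduct_sq (y : κ → ℝ) : ∫ g, (g ⬝ᵥ y) ^ 2 ∂(stdPi κ) = y ⬝ᵥ y := by
  rw [integral_dotProduct_pow, integral_sq_gaussianReal,
    Real.coe_toNNReal _ (dotProduct_self_nonneg y)]

theorem integral_dotProduct_pow_four (y : κ → ℝ) :
    ∫ g, (g ⬝ᵥ y) ^ 4 ∂(stdPi κ) = 3 * (y ⬝ᵥ y) ^ 2 := by
  rw [integral_dotProduct_pow, integral_pow_four_gaussianReal,
    Real.coe_toNNReal _ (dotProduct_self_nonneg y)]

theorem memLp_dotProduct_sq (y : κ → ℝ) : MemLp (fun g => (g ⬝ᵥ y) ^ 2) 2 (stdPi κ) :=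
  (memLp_sq_gaussianReal _).comp_measurePreserving (measurePreserving_dotProduct y)

theorem variance_dotProduct_sq (y : κ → ℝ) :
    Var[fun g => (g ⬝ᵥ y) ^ 2; stdPi κ] = 2 * (y ⬝ᵥ y) ^ 2 := by
  rw [(measurePreserving_dotProduct y).variance_fun_comp (f := fun x => x ^ 2) (by fun_prop),
    variance_sq_gaussianReal, Real.coe_toNNReal _ (dotProduct_self_nonneg y)]

theorem dotProduct_self_eq_weightedSum (g : κ → ℝ) : g ⬝ᵥ g = ∑ j, 1 * g j ^ 2 :=
  Finset.sum_congr rfl fun j _ => by ring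

theorem memLp_dotProduct_self : MemLp (fun g : κ → ℝ => g ⬝ᵥ g) 2 (stdPi κ) := by
  simpa only [dotProduct_self_eq_weightedSum]
    using memLp_weightedSum_pi (memLp_sq_gaussianReal 1) fun _ : κ => 1

theorem integral_dotProduct_self : ∫ g, g ⬝ᵥ g ∂(stdPi κ) = Fintype.card κ := by
  simp only [dotProduct_self_eq_weightedSum]
  rw [integral_weightedSum_pi (integrable_pow_gaussianReal 1 2), integral_sq_gaussianReal]
  simp

theorem variance_dotProduct_self :
    Var[fun g => g ⬝ᵥ g; stdPi κ] = 2 * Fintype.card κ := by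
  simp only [dotProduct_self_eq_weightedSum]
  rw [variance_weightedSum_pi (memLp_sq_gaussianReal 1), variance_sq_gaussianReal]
  simp [mul_comm]

theorem dotProduct_mul_dotProduct_eq_polarization (g u v : κ → ℝ) :
    g ⬝ᵥ u * g ⬝ᵥ v = 1 / 4 * ((g ⬝ᵥ (u + v)) ^ 2 - (g ⬝ᵥ (u - v)) ^ 2) := by
  rw [dotProduct_add, dotProduct_sub]
  ring

theorem memLp_dotProduct_mul_dotProduct (u v : κ → ℝ) :
    MemLp (fun g => g ⬝ᵥ u * g ⬝ᵥ v) 2 (stdPi κ) := by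
  simp_rw [dotProduct_mul_dotProduct_eq_polarization]
  exact ((memLp_dotProduct_sq (u + v)).sub (memLp_dotProduct_sq (u - v))).const_mul _

theorem integral_dotProduct_mul_dotProduct (u v : κ → ℝ) :
    ∫ g, g ⬝ᵥ u * g ⬝ᵥ v ∂(stdPi κ) = u ⬝ᵥ v := by
  simp_rw [dotProduct_mul_dotProduct_eq_polarization]
  rw [integral_const_mul, integral_sub ((memLp_dotProduct_sq _).integrable one_le_two)
    ((memLp_dotProduct_sq _).integrable one_le_two), integral_dotProduct_sq,
    integral_dotProduct_sq]
  simp only [add_dotProduct, dotProduct_add, sub_dotProduct, dotProduct_sub, dotProduct_comm v u]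
  ring

theorem variance_dotProduct_mul_dotProduct_le (u v : κ → ℝ) :
    Var[fun g => g ⬝ᵥ u * g ⬝ᵥ v; stdPi κ] ≤ 3 / 2 * ((u ⬝ᵥ u) ^ 2 + (v ⬝ᵥ v) ^ 2) := by
  have am_gm (g : κ → ℝ) :
      (g ⬝ᵥ u * g ⬝ᵥ v) ^ 2 ≤ 1 / 2 * ((g ⬝ᵥ u) ^ 4 + (g ⬝ᵥ v) ^ 4) := by
    nlinarith [sq_nonneg ((g ⬝ᵥ u) ^ 2 - (g ⬝ᵥ v) ^ 2)]
  calc Var[fun g => g ⬝ᵥ u * g ⬝ᵥ v; stdPi κ]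
    _ ≤ ∫ g, (g ⬝ᵥ u * g ⬝ᵥ v) ^ 2 ∂(stdPi κ) :=
        variance_le_expectation_sq (memLp_dotProduct_mul_dotProduct u v).aestronglyMeasurable
    _ ≤ ∫ g, 1 / 2 * ((g ⬝ᵥ u) ^ 4 + (g ⬝ᵥ v) ^ 4) ∂(stdPi κ) :=
        integral_mono (memLp_dotProduct_mul_dotProduct u v).integrable_sq
          (((integrable_dotProduct_pow u 4).add
            (integrable_dotProduct_pow v 4)).const_mul _) am_gm
    _ = 3 / 2 * ((u ⬝ᵥ u) ^ 2 + (v ⬝ᵥ v) ^ 2) := by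
        rw [integral_const_mul, integral_add (integrable_dotProduct_pow u 4)
          (integrable_dotProduct_pow v 4), integral_dotProduct_pow_four,
          integral_dotProduct_pow_four]
        ring

end StandardGaussianVectors

section LambdaMin

variable {ι : Type} [Fintype ι] [DecidableEq ι] {M : Matrix ι ι ℝ}

theorem lambdaMin_eq_iInf_eigenvalues (hM : M.IsHermitian) :
    lambdaMin M = ⨅ i, hM.eigenvalues i := by
  rw [lambdaMin, hM.spectrum_real_eq_range_eigenvalues, iInf]

theorem exists_eigenvalue_eq_lambdaMin [Nonempty ι] (hM : M.IsHermitian) :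
    ∃ i, hM.eigenvalues i = lambdaMin M := by
  rw [lambdaMin_eq_iInf_eigenvalues hM]
  exact exists_eq_ciInf_of_finite

theorem exists_unit_quadraticForm_eq_lambdaMin [Nonempty ι] (hM : M.IsHermitian) :
    ∃ x : ι → ℝ, x ⬝ᵥ x = 1 ∧ x ⬝ᵥ M *ᵥ x = lambdaMin M := by
  obtain ⟨i, hi⟩ := exists_eigenvalue_eq_lambdaMin hM
  have unit : (hM.eigenvectorBasis i : ι → ℝ) ⬝ᵥ (hM.eigenvectorBasis i : ι → ℝ) = 1 := by
    have norm_sq := EuclideanSpace.real_norm_sq_eq (hM.eigenvectorBasis i)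
    rw [hM.eigenvectorBasis.orthonormal.1 i, one_pow] at norm_sq
    simp only [dotProduct, ← sq, ← norm_sq]
  refine ⟨hM.eigenvectorBasis i, unit, ?_⟩
  rw [hM.mulVec_eigenvectorBasis, dotProduct_smul, smul_eq_mul, unit, hi, mul_one]

theorem lambdaMin_mul_le (hM : M.IsHermitian) (x : ι → ℝ) :
    lambdaMin M * (x ⬝ᵥ x) ≤ x ⬝ᵥ M *ᵥ x := by
  have shifted : (M - lambdaMin M • (1 : Matrix ι ι ℝ)).PosSemidef := by
    rw [Matrix.posSemidef_iff_isHermitian_and_spectrum_nonneg]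
    refine ⟨hM.sub (Matrix.isHermitian_one.smul (IsSelfAdjoint.all _)), ?_⟩
    rw [← Algebra.algebraMap_eq_smul_one, ← spectrum.sub_singleton_eq,
      hM.spectrum_real_eq_range_eigenvalues]
    rintro _ ⟨_, ⟨i, rfl⟩, _, rfl, rfl⟩
    rw [lambdaMin_eq_iInf_eigenvalues hM]
    exact sub_nonneg.2 (ciInf_le (Set.finite_range hM.eigenvalues).bddBelow i)
  have h := shifted.dotProduct_mulVec_nonneg x
  simpa only [star_trivial, Matrix.sub_mulVec, dotProduct_sub, Matrix.smul_mulVec,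
    Matrix.one_mulVec, dotProduct_smul, smul_eq_mul, sub_nonneg] using h

theorem le_lambdaMin_iff [Nonempty ι] (hM : M.IsHermitian) (c : ℝ) :
    c ≤ lambdaMin M ↔ ∀ x : ι → ℝ, c * (x ⬝ᵥ x) ≤ x ⬝ᵥ M *ᵥ x := by
  refine ⟨fun hc x => ?_, fun h => ?_⟩
  · exact (mul_le_mul_of_nonneg_right hc (dotProduct_self_nonneg x)).trans (lambdaMin_mul_le hM x)
  · obtain ⟨x, unit, hx⟩ := exists_unit_quadraticForm_eq_lambdaMin hM
    simpa only [unit, hx, mul_one] using h x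

theorem posSemidef_iff_lambdaMin_nonneg [Nonempty ι] (hM : M.IsHermitian) :
    M.PosSemidef ↔ 0 ≤ lambdaMin M := by
  rw [Matrix.posSemidef_iff_dotProduct_mulVec, le_lambdaMin_iff hM]
  simp only [hM, true_and, zero_mul, star_trivial]

end LambdaMin

section FrobNorm

variable {ι κ : Type} [Fintype ι] [Fintype κ] (M : Matrix ι κ ℝ)

theorem frobNorm_nonneg : 0 ≤ frobNorm M := Real.sqrt_nonneg _

theorem frobNorm_sq : frobNorm M ^ 2 = ∑ i, ∑ j, M i j ^ 2 :=
  Real.sq_sqrt (Finset.sum_nonneg fun _ _ => Finset.sum_nonneg fun _ _ => sq_nonneg _)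

theorem frobNorm_sq_eq_sum_dotProduct : frobNorm M ^ 2 = ∑ i, M i ⬝ᵥ M i := by
  rw [frobNorm_sq]
  simp only [dotProduct, sq]

theorem frobNorm_sq_eq_trace : frobNorm M ^ 2 = (M * Mᵀ).trace :=
  frobNorm_sq_eq_sum_dotProduct M

theorem frobNorm_pos {M : Matrix ι κ ℝ} (hM : M ≠ 0) : 0 < frobNorm M := by
  refine (frobNorm_nonneg M).lt_of_ne' fun h => hM ?_
  have trace_zero : (M * Mᵀ).trace = 0 := by rw [← frobNorm_sq_eq_trace, h, zero_pow two_ne_zero]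
  exact Matrix.trace_mul_conjTranspose_self_eq_zero_iff.1 trace_zero

end FrobNorm

section Diagonalisation

variable {d : ℕ} {κ : Type} {A : Matrix (Fin d) (Fin d) ℝ}

theorem isHermitian_bilinearSketch (hA : A.IsHermitian) (G : Matrix (Fin d) κ ℝ) :
    (bilinearSketch A G).IsHermitian :=
  Matrix.isHermitian_conjTranspose_mul_mul G hA

theorem bilinearSketch_apply_eq_dotProduct (G : Matrix (Fin d) κ ℝ) (i j : κ) :
    bilinearSketch A G i j = G.col i ⬝ᵥ A *ᵥ G.col j := by
  rw [bilinearSketch, Matrix.mul_assoc]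
  rfl

theorem bilinearSketch_diagonal_apply (a : Fin d → ℝ) (G : Matrix (Fin d) κ ℝ) (i j : κ) :
    bilinearSketch (Matrix.diagonal a) G i j = ∑ r, a r * (G r i * G r j) := by
  rw [bilinearSketch, Matrix.mul_apply]
  refine Finset.sum_congr rfl fun r _ => ?_
  rw [Matrix.mul_diagonal, Matrix.transpose_apply]
  ring

theorem dotProduct_bilinearSketch_diagonal [Fintype κ] (a : Fin d → ℝ) (G : Matrix (Fin d) κ ℝ)
    (x : κ → ℝ) :
    x ⬝ᵥ bilinearSketch (Matrix.diagonal a) G *ᵥ x = ∑ r, a r * (G r ⬝ᵥ x) ^ 2 := by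
  have factor : x ⬝ᵥ bilinearSketch (Matrix.diagonal a) G *ᵥ x =
      (G *ᵥ x) ⬝ᵥ Matrix.diagonal a *ᵥ (G *ᵥ x) := by
    rw [bilinearSketch, Matrix.mul_assoc, ← Matrix.mulVec_mulVec, ← Matrix.mulVec_mulVec,
      Matrix.dotProduct_mulVec, Matrix.vecMul_transpose]
  rw [factor]
  refine Finset.sum_congr rfl fun r _ => ?_
  rw [Matrix.mulVec_diagonal, Matrix.mulVec]
  ring

theorem eq_eigenvectorUnitary_mul_diagonal_mul (hA : A.IsHermitian) :
    A = (hA.eigenvectorUnitary : Matrix (Fin d) (Fin d) ℝ) * Matrix.diagonal hA.eigenvalues *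
      (hA.eigenvectorUnitary : Matrix (Fin d) (Fin d) ℝ)ᵀ := by
  simpa [Unitary.conjStarAlgAut_apply, Matrix.star_eq_conjTranspose] using hA.spectral_theorem

theorem bilinearSketch_eq_diagonal_eigenvalues (hA : A.IsHermitian) (G : Matrix (Fin d) κ ℝ) :
    bilinearSketch A G = bilinearSketch (Matrix.diagonal hA.eigenvalues)
      ((hA.eigenvectorUnitary : Matrix (Fin d) (Fin d) ℝ)ᵀ * G) := by
  conv_lhs => rw [eq_eigenvectorUnitary_mul_diagonal_mul hA]
  simp only [bilinearSketch, Matrix.transpose_mul, Matrix.transpose_transpose, Matrix.mul_assoc]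

theorem trace_eq_sum_eigenvalues (hA : A.IsHermitian) : A.trace = ∑ r, hA.eigenvalues r := by
  simpa using hA.trace_eq_sum_eigenvalues

theorem frobNorm_sq_eq_sum_eigenvalues_sq (hA : A.IsHermitian) :
    frobNorm A ^ 2 = ∑ r, hA.eigenvalues r ^ 2 := by
  have orthogonal : (hA.eigenvectorUnitary : Matrix (Fin d) (Fin d) ℝ)ᵀ *
      (hA.eigenvectorUnitary : Matrix (Fin d) (Fin d) ℝ) = 1 :=
    Matrix.mem_unitaryGroup_iff'.1 hA.eigenvectorUnitary.2
  have eq := eq_eigenvectorUnitary_mul_diagonal_mul hA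
  set U := (hA.eigenvectorUnitary : Matrix (Fin d) (Fin d) ℝ)
  set D := Matrix.diagonal hA.eigenvalues
  calc frobNorm A ^ 2 = ((U * D * Uᵀ) * (U * D * Uᵀ)).trace := by
        rw [frobNorm_sq_eq_trace, ← Matrix.conjTranspose_eq_transpose_of_trivial, hA.eq, ← eq]
    _ = (U * (D * (Uᵀ * U) * D * Uᵀ)).trace := by simp only [Matrix.mul_assoc]
    _ = (D * D).trace := by
        rw [orthogonal, Matrix.mul_one, Matrix.trace_mul_comm, Matrix.mul_assoc, orthogonal,
          Matrix.mul_one]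
    _ = ∑ r, hA.eigenvalues r ^ 2 := by
        rw [Matrix.diagonal_mul_diagonal, Matrix.trace_diagonal]
        simp only [sq]

end Diagonalisation

section GaussianMatrices

theorem measurable_entry {ι κ : Type} (i : ι) (j : κ) :
    Measurable fun X : Matrix ι κ ℝ => X i j :=
  (measurable_pi_apply j).comp (measurable_pi_apply i)

theorem measurePreserving_pi_transpose (ι κ : Type*) [Fintype ι] [Fintype κ] {E : Type*}
    [MeasurableSpace E] (ν : Measure E) [IsProbabilityMeasure ν] :
    MeasurePreserving (fun (X : ι → κ → E) j i => X i j)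
      (Measure.pi fun _ : ι => Measure.pi fun _ : κ => ν)
      (Measure.pi fun _ : κ => Measure.pi fun _ : ι => ν) := by
  have uncurry : MeasurePreserving (MeasurableEquiv.curry ι κ E).symm
      (Measure.pi fun _ : ι => Measure.pi fun _ : κ => ν) (Measure.pi fun _ : ι × κ => ν) :=
    ⟨MeasurableEquiv.measurable _, by
      simpa only [Measure.infinitePi_eq_pi]
        using Measure.infinitePi_map_curry_symm fun (_ : ι) (_ : κ) => ν⟩
  have curry : MeasurePreserving (MeasurableEquiv.curry κ ι E) (Measure.pi fun _ : κ × ι => ν)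
      (Measure.pi fun _ : κ => Measure.pi fun _ : ι => ν) :=
    ⟨MeasurableEquiv.measurable _, by
      simpa only [Measure.infinitePi_eq_pi]
        using Measure.infinitePi_map_curry fun (_ : κ) (_ : ι) => ν⟩
  have swap := measurePreserving_piCongrLeft (fun _ : κ × ι => ν) (Equiv.prodComm ι κ)
  convert curry.comp (swap.comp uncurry) using 1
  funext X j i
  exact (Equiv.piCongrLeft_apply_apply (fun _ : κ × ι => E) (Equiv.prodComm ι κ)
    (fun p => X p.1 p.2) (i, j)).symm

theorem measurePreserving_transpose_gaussianMatrix (d : ℕ) (κ : Type) [Fintype κ] :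
    MeasurePreserving (fun (X : Matrix (Fin d) κ ℝ) j => X.col j) (gaussianMatrix d κ)
      (Measure.pi fun _ : κ => stdPi (Fin d)) :=
  measurePreserving_pi_transpose (Fin d) κ (gaussianReal 0 1)

theorem measurePreserving_row {d : ℕ} (κ : Type) [Fintype κ] (r : Fin d) :
    MeasurePreserving (fun Y : Matrix (Fin d) κ ℝ => Y r) (gaussianMatrix d κ) (stdPi κ) :=
  measurePreserving_eval (fun _ : Fin d => stdPi κ) r

theorem measurePreserving_mulVec_stdPi {ι : Type*} [Fintype ι] [DecidableEq ι]
    {U : Matrix ι ι ℝ} (hU : U ∈ Matrix.orthogonalGroup ι ℝ) :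
    MeasurePreserving (U *ᵥ ·) (stdPi ι) (stdPi ι) := by
  have toLp : MeasurePreserving (WithLp.toLp 2) (stdPi ι) (stdGaussian (EuclideanSpace ℝ ι)) :=
    ⟨by fun_prop, map_pi_eq_stdGaussian⟩
  have ofLp : MeasurePreserving (WithLp.ofLp (p := 2)) (stdGaussian (EuclideanSpace ℝ ι))
      (stdPi ι) :=
    toLp.symm (MeasurableEquiv.toLp 2 (ι → ℝ))
  have isometry := stdGaussian_map (Unitary.linearIsometryEquiv
    ⟨_, Unitary.map_mem (Matrix.toEuclideanCLM (n := ι) (𝕜 := ℝ)) hU⟩)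
  exact ofLp.comp (.comp ⟨LinearIsometryEquiv.continuous _ |>.measurable, isometry⟩ toLp)

theorem measurePreserving_mul_gaussianMatrix {d : ℕ} (κ : Type) [Fintype κ]
    {U : Matrix (Fin d) (Fin d) ℝ} (hU : U ∈ Matrix.orthogonalGroup (Fin d) ℝ) :
    MeasurePreserving (U * ·) (gaussianMatrix d κ) (gaussianMatrix d κ) :=
  (measurePreserving_pi_transpose κ (Fin d) (gaussianReal 0 1)).comp
    ((measurePreserving_pi _ _ fun _ : κ => measurePreserving_mulVec_stdPi hU).comp
      (measurePreserving_pi_transpose (Fin d) κ (gaussianReal 0 1)))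

theorem real_bilinearSketch_mem_le_diagonal_eigenvalues {d : ℕ} {κ : Type} [Fintype κ]
    {A : Matrix (Fin d) (Fin d) ℝ} (hA : A.IsHermitian) (B : Set (Matrix κ κ ℝ)) :
    (gaussianMatrix d κ).real {G | bilinearSketch A G ∈ B} ≤
      (gaussianMatrix d κ).real {Y | bilinearSketch (Matrix.diagonal hA.eigenvalues) Y ∈ B} := by
  simp_rw [bilinearSketch_eq_diagonal_eigenvalues hA]
  exact measureReal_preimage_le
    (measurePreserving_mul_gaussianMatrix κ (Unitary.star_mem hA.eigenvectorUnitary.2))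
    {Y | bilinearSketch (Matrix.diagonal hA.eigenvalues) Y ∈ B}

end GaussianMatrices

section TraceEstimate

variable {d m : ℕ}

/-- The estimator of `Tr A` from an `m × m` sketch of `A`: the average of its diagonal entries. -/
noncomputable def traceEstimate (m : ℕ) (S : Matrix (Fin m) (Fin m) ℝ) : ℝ :=
  (1 / m : ℝ) * ∑ j, S j j

theorem measurable_traceEstimate (m : ℕ) : Measurable (traceEstimate m) :=
  (Finset.measurable_sum _ fun j _ => measurable_entry j j).const_mul _

theorem traceEstimate_bilinearSketch_diagonal (a : Fin d → ℝ) (Y : Matrix (Fin d) (Fin m) ℝ) :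
    traceEstimate m (bilinearSketch (Matrix.diagonal a) Y) =
      ∑ r, a r * ((1 / m : ℝ) * (Y r ⬝ᵥ Y r)) := by
  simp only [traceEstimate, bilinearSketch_diagonal_apply, dotProduct]
  rw [Finset.sum_comm, Finset.mul_sum]
  refine Finset.sum_congr rfl fun r _ => ?_
  rw [← Finset.mul_sum]
  ring

theorem real_traceEstimate_deviation_le (hm : 0 < m) {A : Matrix (Fin d) (Fin d) ℝ}
    (hA : A.IsHermitian) :
    (gaussianMatrix d (Fin m)).real
      {H | frobNorm A < |traceEstimate m (bilinearSketch A H) - A.trace|} ≤ 2 / m := by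
  have hm' : (m : ℝ) ≠ 0 := by positivity
  have memLp : MemLp (fun y : Fin m → ℝ => (1 / m : ℝ) * (y ⬝ᵥ y)) 2 (stdPi (Fin m)) :=
    memLp_dotProduct_self.const_mul _
  set μ := Measure.pi fun _ : Fin d => stdPi (Fin m)
  have mean : ∫ Y, ∑ r, hA.eigenvalues r * ((1 / m : ℝ) * (Y r ⬝ᵥ Y r)) ∂μ = A.trace := by
    rw [integral_weightedSum_pi (memLp.integrable one_le_two),
      integral_const_mul, integral_dotProduct_self, trace_eq_sum_eigenvalues hA, Fintype.card_fin,
      one_div_mul_cancel hm', mul_one]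
  have variance : Var[fun Y => ∑ r, hA.eigenvalues r * ((1 / m : ℝ) * (Y r ⬝ᵥ Y r)); μ] =
      2 / m * frobNorm A ^ 2 := by
    rw [variance_weightedSum_pi memLp, variance_const_mul,
      variance_dotProduct_self, frobNorm_sq_eq_sum_eigenvalues_sq hA, Fintype.card_fin]
    field_simp
  refine (real_bilinearSketch_mem_le_diagonal_eigenvalues hA
    {S | frobNorm A < |traceEstimate m S - A.trace|}).trans ?_
  have chebyshev := measureReal_lt_abs_sub_integral_le
    (memLp_weightedSum_pi memLp hA.eigenvalues) (by positivity) (frobNorm_nonneg A) variance.le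
  rw [mean] at chebyshev
  simp only [Set.mem_ofPred_eq, traceEstimate_bilinearSketch_diagonal]
  exact chebyshev

end TraceEstimate

section BilinearForms

variable {ι κ : Type} [Fintype ι] [Fintype κ] (M : Matrix ι κ ℝ)

theorem mulVec_dotProduct_self_eq_sum (y : κ → ℝ) :
    (M *ᵥ y) ⬝ᵥ (M *ᵥ y) = ∑ i, (y ⬝ᵥ M i) ^ 2 :=
  Finset.sum_congr rfl fun i _ => by rw [dotProduct_comm y, sq, Matrix.mulVec]

theorem memLp_mulVec_dotProduct_self :
    MemLp (fun y => (M *ᵥ y) ⬝ᵥ (M *ᵥ y)) 2 (stdPi κ) := by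
  simp_rw [mulVec_dotProduct_self_eq_sum]
  exact memLp_finsetSum _ fun i _ => memLp_dotProduct_sq (M i)

theorem integral_mulVec_dotProduct_self :
    ∫ y, (M *ᵥ y) ⬝ᵥ (M *ᵥ y) ∂(stdPi κ) = frobNorm M ^ 2 := by
  simp_rw [mulVec_dotProduct_self_eq_sum]
  rw [integral_finsetSum _ fun i _ => integrable_dotProduct_pow (M i) 2,
    frobNorm_sq_eq_sum_dotProduct]
  exact Finset.sum_congr rfl fun i _ => integral_dotProduct_sq (M i)

theorem mulVec_dotProduct_self_sq_le (y : κ → ℝ) :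
    ((M *ᵥ y) ⬝ᵥ (M *ᵥ y)) ^ 2 ≤ frobNorm M ^ 2 * ∑ i, (y ⬝ᵥ M i) ^ 4 / (M i ⬝ᵥ M i) := by
  rw [mulVec_dotProduct_self_eq_sum, frobNorm_sq_eq_sum_dotProduct]
  refine Finset.sum_sq_le_sum_mul_sum_of_sq_le_mul _ (fun i _ => dotProduct_self_nonneg _)
    (fun i _ => div_nonneg (by positivity) (dotProduct_self_nonneg _)) fun i _ => ?_
  rcases eq_or_ne (M i) 0 with zero | nonzero
  · simp [zero]
  · rw [mul_div_cancel₀ _ (dotProduct_self_eq_zero.not.2 nonzero), ← pow_mul]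

theorem integral_mulVec_dotProduct_self_sq_le :
    ∫ y, ((M *ᵥ y) ⬝ᵥ (M *ᵥ y)) ^ 2 ∂(stdPi κ) ≤ 3 * frobNorm M ^ 4 := by
  have integrable (i : ι) :
      Integrable (fun y => (y ⬝ᵥ M i) ^ 4 / (M i ⬝ᵥ M i)) (stdPi κ) :=
    (integrable_dotProduct_pow (M i) 4).div_const _
  calc ∫ y, ((M *ᵥ y) ⬝ᵥ (M *ᵥ y)) ^ 2 ∂(stdPi κ)
    _ ≤ ∫ y, frobNorm M ^ 2 * ∑ i, (y ⬝ᵥ M i) ^ 4 / (M i ⬝ᵥ M i) ∂(stdPi κ) :=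
        integral_mono (memLp_mulVec_dotProduct_self M).integrable_sq
          ((integrable_finsetSum _ fun i _ => integrable i).const_mul _)
          (mulVec_dotProduct_self_sq_le M)
    _ = frobNorm M ^ 2 * ∑ i, 3 * (M i ⬝ᵥ M i) := by
        rw [integral_const_mul, integral_finsetSum _ fun i _ => integrable i]
        simp only [integral_div, integral_dotProduct_pow_four]
        refine congrArg _ (Finset.sum_congr rfl fun i _ => ?_)
        rw [mul_div_assoc, sq, mul_self_div_self]
    _ = 3 * frobNorm M ^ 4 := by
        rw [← Finset.mul_sum, ← frobNorm_sq_eq_sum_dotProduct]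
        ring

theorem measurable_bilinearForm :
    Measurable fun p : (ι → ℝ) × (κ → ℝ) => p.1 ⬝ᵥ M *ᵥ p.2 := by
  unfold dotProduct Matrix.mulVec dotProduct
  fun_prop

theorem integrable_bilinearForm_pow_four :
    Integrable (fun p => (p.1 ⬝ᵥ M *ᵥ p.2) ^ 4) ((stdPi ι).prod (stdPi κ)) := by
  refine (integrable_prod_iff'
    ((measurable_bilinearForm M).pow_const 4).aestronglyMeasurable).2
    ⟨.of_forall fun y => integrable_dotProduct_pow (M *ᵥ y) 4, ?_⟩
  have even (x : ι → ℝ) (y : κ → ℝ) : ‖(x ⬝ᵥ M *ᵥ y) ^ 4‖ = (x ⬝ᵥ M *ᵥ y) ^ 4 :=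
    Real.norm_of_nonneg (by positivity)
  simp only [even, integral_dotProduct_pow_four]
  exact (memLp_mulVec_dotProduct_self M).integrable_sq.const_mul 3

theorem memLp_bilinearForm_sq :
    MemLp (fun p => (p.1 ⬝ᵥ M *ᵥ p.2) ^ 2) 2 ((stdPi ι).prod (stdPi κ)) := by
  rw [memLp_two_iff_integrable_sq
    ((measurable_bilinearForm M).pow_const 2).aestronglyMeasurable]
  simpa only [← pow_mul] using integrable_bilinearForm_pow_four M

theorem integral_bilinearForm_sq :
    ∫ p, (p.1 ⬝ᵥ M *ᵥ p.2) ^ 2 ∂((stdPi ι).prod (stdPi κ)) = frobNorm M ^ 2 := by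
  rw [integral_prod_symm _ ((memLp_bilinearForm_sq M).integrable one_le_two)]
  simp only [integral_dotProduct_sq, integral_mulVec_dotProduct_self]

theorem variance_bilinearForm_sq_le :
    Var[fun p => (p.1 ⬝ᵥ M *ᵥ p.2) ^ 2; (stdPi ι).prod (stdPi κ)] ≤ 9 * frobNorm M ^ 4 := by
  calc Var[fun p => (p.1 ⬝ᵥ M *ᵥ p.2) ^ 2; (stdPi ι).prod (stdPi κ)]
    _ ≤ ∫ p, (p.1 ⬝ᵥ M *ᵥ p.2) ^ 4 ∂((stdPi ι).prod (stdPi κ)) := by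
        refine (variance_le_expectation_sq
          (memLp_bilinearForm_sq M).aestronglyMeasurable).trans_eq ?_
        simp only [Pi.pow_apply, ← pow_mul, Nat.reduceMul]
    _ = 3 * ∫ y, ((M *ᵥ y) ⬝ᵥ (M *ᵥ y)) ^ 2 ∂(stdPi κ) := by
        rw [integral_prod_symm _ (integrable_bilinearForm_pow_four M)]
        simp only [integral_dotProduct_pow_four, integral_const_mul]
    _ ≤ 9 * frobNorm M ^ 4 := by linarith [integral_mulVec_dotProduct_self_sq_le M]

end BilinearForms

section FrobEstimate

variable {d n : ℕ}

/-- The estimator of `‖A‖_F` from a sketch of `A` with `n + n` columns: the root mean square of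
the `n` entries indexed by the disjoint pairs of columns `(i, n + i)`. These entries are
independent bilinear forms in `A`. -/
noncomputable def frobEstimate (n : ℕ) (S : Matrix (Fin (n + n)) (Fin (n + n)) ℝ) : ℝ :=
  Real.sqrt ((1 / n : ℝ) * ∑ i : Fin n, S (Fin.castAdd n i) (Fin.natAdd n i) ^ 2)

theorem measurable_frobEstimate (n : ℕ) : Measurable (frobEstimate n) :=
  ((Finset.measurable_sum _ fun _ _ => (measurable_entry _ _).pow_const 2).const_mul _).sqrt

theorem measurePreserving_pi_pairs {E : Type*} [MeasurableSpace E] (ν : Measure E)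
    [IsProbabilityMeasure ν] (n : ℕ) :
    MeasurePreserving (fun (x : Fin (n + n) → E) i => (x (Fin.castAdd n i), x (Fin.natAdd n i)))
      (Measure.pi fun _ : Fin (n + n) => ν) (Measure.pi fun _ : Fin n => ν.prod ν) := by
  have split := measurePreserving_piCongrLeft (fun _ : Fin n ⊕ Fin n => ν) finSumFinEquiv.symm
  have halves := measurePreserving_sumPiEquivProdPi fun _ : Fin n ⊕ Fin n => ν
  have zip := (measurePreserving_arrowProdEquivProdArrow E E (Fin n)
    (fun _ => ν) fun _ => ν).symm
  convert zip.comp (halves.comp split) using 1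
  funext x i
  have sum_apply (s : Fin n ⊕ Fin n) :
      MeasurableEquiv.piCongrLeft (fun _ => E) finSumFinEquiv.symm x s = x (finSumFinEquiv s) := by
    simpa using MeasurableEquiv.piCongrLeft_apply_apply (β := fun _ => E)
      finSumFinEquiv.symm x (finSumFinEquiv s)
  exact Prod.ext (sum_apply (Sum.inl i)).symm (sum_apply (Sum.inr i)).symm

theorem half_le_frobEstimate_le_two_mul {c : ℝ} (hc : 0 ≤ c)
    {S : Matrix (Fin (n + n)) (Fin (n + n)) ℝ}
    (h : |∑ i : Fin n, (1 / n : ℝ) * S (Fin.castAdd n i) (Fin.natAdd n i) ^ 2 - c ^ 2| ≤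
      3 / 4 * c ^ 2) :
    c / 2 ≤ frobEstimate n S ∧ frobEstimate n S ≤ 2 * c := by
  rw [← Finset.mul_sum, abs_le] at h
  refine ⟨Real.le_sqrt_of_sq_le ?_, Real.sqrt_le_iff.2 ⟨by positivity, ?_⟩⟩
  · linarith
  · nlinarith

theorem real_frobEstimate_deviation_le (hn : 0 < n) (A : Matrix (Fin d) (Fin d) ℝ) :
    (gaussianMatrix d (Fin (n + n))).real
      {H | ¬ (frobNorm A / 2 ≤ frobEstimate n (bilinearSketch A H) ∧
        frobEstimate n (bilinearSketch A H) ≤ 2 * frobNorm A)} ≤ 16 / n := by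
  have hn' : (n : ℝ) ≠ 0 := by positivity
  set ν := (stdPi (Fin d)).prod (stdPi (Fin d))
  have memLp : MemLp (fun p => (p.1 ⬝ᵥ A *ᵥ p.2) ^ 2) 2 ν := memLp_bilinearForm_sq A
  have mean : ∫ x, ∑ i : Fin n, (1 / n : ℝ) * ((x i).1 ⬝ᵥ A *ᵥ (x i).2) ^ 2
      ∂(Measure.pi fun _ => ν) = frobNorm A ^ 2 := by
    rw [integral_weightedSum_pi (memLp.integrable one_le_two), integral_bilinearForm_sq,
      Finset.sum_const, Finset.card_univ, Fintype.card_fin, nsmul_eq_mul, mul_one_div_cancel hn',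
      one_mul]
  have variance : Var[fun x => ∑ i : Fin n, (1 / n : ℝ) * ((x i).1 ⬝ᵥ A *ᵥ (x i).2) ^ 2;
      Measure.pi fun _ => ν] ≤ 16 / n * (3 / 4 * frobNorm A ^ 2) ^ 2 := by
    rw [variance_weightedSum_pi memLp]
    calc (∑ _ : Fin n, (1 / n : ℝ) ^ 2) * Var[fun p => (p.1 ⬝ᵥ A *ᵥ p.2) ^ 2; ν]
      _ ≤ (∑ _ : Fin n, (1 / n : ℝ) ^ 2) * (9 * frobNorm A ^ 4) := by
          gcongr
          exact variance_bilinearForm_sq_le A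
      _ = 16 / n * (3 / 4 * frobNorm A ^ 2) ^ 2 := by
          rw [Finset.sum_const, Finset.card_univ, Fintype.card_fin, nsmul_eq_mul]
          field_simp
          ring
  have chebyshev := measureReal_lt_abs_sub_integral_le
    (memLp_weightedSum_pi memLp fun _ : Fin n => (1 / n : ℝ)) (by positivity) (by positivity)
    variance
  rw [mean] at chebyshev
  have pairs := (measurePreserving_pi_pairs (stdPi (Fin d)) n).comp
    (measurePreserving_transpose_gaussianMatrix d (Fin (n + n)))
  refine (measureReal_mono (fun H bad => ?_) (measure_ne_top _ _)).trans
    ((measureReal_preimage_le pairs _).trans chebyshev)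
  by_contra close
  refine bad (half_le_frobEstimate_le_two_mul (frobNorm_nonneg A) ?_)
  simpa only [bilinearSketch_apply_eq_dotProduct] using not_lt.1 close

end FrobEstimate

section LowerTail

variable {ι κ : Type*} [Fintype ι] [Fintype κ]

theorem exp_neg_le_quadratic {u : ℝ} (hu : 0 ≤ u) : Real.exp (-u) ≤ 1 - u + u ^ 2 / 2 := by
  have pos : 0 < 1 + u + u ^ 2 / 2 := by positivity
  rw [Real.exp_neg]
  refine (inv_anti₀ pos (Real.quadratic_le_exp_of_nonneg hu)).trans ?_
  rw [inv_le_iff_one_le_mul₀ pos]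
  nlinarith [sq_nonneg (u ^ 2)]

theorem integrable_exp_neg_mul_dotProduct_sq (y : κ → ℝ) {b : ℝ} (hb : 0 ≤ b) :
    Integrable (fun g => Real.exp (-(b * (g ⬝ᵥ y) ^ 2))) (stdPi κ) := by
  have : Measurable fun g : κ → ℝ => g ⬝ᵥ y := measurable_dotProduct_right y
  refine Integrable.of_bound (C := 1) (by fun_prop) (.of_forall fun g => ?_)
  rw [Real.norm_eq_abs, Real.abs_exp, Real.exp_le_one_iff, neg_nonpos]
  positivity

theorem integral_exp_neg_mul_dotProduct_sq_le (y : κ → ℝ) {b : ℝ} (hb : 0 ≤ b) :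
    ∫ g, Real.exp (-(b * (g ⬝ᵥ y) ^ 2)) ∂(stdPi κ) ≤
      Real.exp (-(b * (y ⬝ᵥ y)) + 3 / 2 * b ^ 2 * (y ⬝ᵥ y) ^ 2) := by
  have linear : Integrable (fun g => 1 - b * (g ⬝ᵥ y) ^ 2) (stdPi κ) :=
    (integrable_const 1).sub ((integrable_dotProduct_pow y 2).const_mul b)
  have quartic : Integrable (fun g => b ^ 2 / 2 * (g ⬝ᵥ y) ^ 4) (stdPi κ) :=
    (integrable_dotProduct_pow y 4).const_mul _
  calc ∫ g, Real.exp (-(b * (g ⬝ᵥ y) ^ 2)) ∂(stdPi κ)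
    _ ≤ ∫ g, (1 - b * (g ⬝ᵥ y) ^ 2 + b ^ 2 / 2 * (g ⬝ᵥ y) ^ 4) ∂(stdPi κ) := by
        refine integral_mono (integrable_exp_neg_mul_dotProduct_sq y hb) (linear.add quartic)
          fun g => (exp_neg_le_quadratic (by positivity)).trans_eq ?_
        ring
    _ = -(b * (y ⬝ᵥ y)) + 3 / 2 * b ^ 2 * (y ⬝ᵥ y) ^ 2 + 1 := by
        rw [integral_add linear quartic, integral_sub (integrable_const 1)
          ((integrable_dotProduct_pow y 2).const_mul b), integral_const_mul, integral_const_mul,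
          integral_dotProduct_sq, integral_dotProduct_pow_four, integral_const, probReal_univ,
          one_smul]
        ring
    _ ≤ Real.exp (-(b * (y ⬝ᵥ y)) + 3 / 2 * b ^ 2 * (y ⬝ᵥ y) ^ 2) := Real.add_one_le_exp _

theorem exp_mul_sub_weightedSum (a : ι → ℝ) (y : κ → ℝ) (θ s : ℝ) (Y : ι → κ → ℝ) :
    Real.exp (θ * (s - ∑ r, a r * (Y r ⬝ᵥ y) ^ 2)) =
      Real.exp (θ * s) * ∏ r, Real.exp (-(θ * a r * (Y r ⬝ᵥ y) ^ 2)) := by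
  rw [← Real.exp_sum, ← Real.exp_add, Finset.sum_neg_distrib, mul_sub, Finset.mul_sum]
  simp only [mul_assoc, sub_eq_add_neg]

theorem integrable_exp_mul_sub_weightedSum {a : ι → ℝ} (ha : ∀ r, 0 ≤ a r) (y : κ → ℝ) {θ : ℝ}
    (hθ : 0 ≤ θ) (s : ℝ) :
    Integrable (fun Y : ι → κ → ℝ => Real.exp (θ * (s - ∑ r, a r * (Y r ⬝ᵥ y) ^ 2)))
      (Measure.pi fun _ : ι => stdPi κ) := by
  simp_rw [exp_mul_sub_weightedSum]
  exact (Integrable.fintype_prod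
    (f := fun r (g : κ → ℝ) => Real.exp (-(θ * a r * (g ⬝ᵥ y) ^ 2)))
    fun r => integrable_exp_neg_mul_dotProduct_sq y (mul_nonneg hθ (ha r))).const_mul _

theorem mgf_sub_weightedSum_le {a : ι → ℝ} (ha : ∀ r, 0 ≤ a r) (y : κ → ℝ) {θ : ℝ}
    (hθ : 0 ≤ θ) :
    mgf (fun Y : ι → κ → ℝ => (∑ r, a r) * (y ⬝ᵥ y) - ∑ r, a r * (Y r ⬝ᵥ y) ^ 2)
      (Measure.pi fun _ : ι => stdPi κ) θ ≤
      Real.exp (3 / 2 * θ ^ 2 * ((∑ r, a r ^ 2) * (y ⬝ᵥ y) ^ 2)) := by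
  have factor : ∏ r, ∫ g, Real.exp (-(θ * a r * (g ⬝ᵥ y) ^ 2)) ∂(stdPi κ) ≤
      Real.exp (∑ r, (-(θ * a r * (y ⬝ᵥ y)) + 3 / 2 * (θ * a r) ^ 2 * (y ⬝ᵥ y) ^ 2)) := by
    rw [Real.exp_sum]
    exact Finset.prod_le_prod (fun r _ => integral_nonneg fun g => (Real.exp_pos _).le)
      fun r _ => integral_exp_neg_mul_dotProduct_sq_le y (mul_nonneg hθ (ha r))
  simp_rw [mgf, exp_mul_sub_weightedSum]
  rw [integral_const_mul, integral_fintype_prod_eq_prod (μ := fun _ : ι => stdPi κ)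
    (f := fun r (g : κ → ℝ) => Real.exp (-(θ * a r * (g ⬝ᵥ y) ^ 2)))]
  refine (mul_le_mul_of_nonneg_left factor (Real.exp_pos _).le).trans_eq ?_
  rw [← Real.exp_add, Finset.sum_add_distrib, Finset.sum_neg_distrib, ← Finset.sum_mul,
    ← Finset.sum_mul, ← Finset.mul_sum, ← Finset.mul_sum]
  simp_rw [mul_pow]
  rw [← Finset.mul_sum]
  congr 1
  ring

theorem real_le_sub_weightedSum_le {a : ι → ℝ} (ha : ∀ r, 0 ≤ a r) (y : κ → ℝ) {V t : ℝ}
    (hV : 0 < V) (hyV : (∑ r, a r ^ 2) * (y ⬝ᵥ y) ^ 2 ≤ V) (ht : 0 ≤ t) :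
    (Measure.pi fun _ : ι => stdPi κ).real
      {Y : ι → κ → ℝ | t ≤ (∑ r, a r) * (y ⬝ᵥ y) - ∑ r, a r * (Y r ⬝ᵥ y) ^ 2} ≤
      Real.exp (-(t ^ 2 / (6 * V))) := by
  obtain ⟨θ, hθ⟩ : ∃ θ, θ = t / (3 * V) := ⟨_, rfl⟩
  have hθ₀ : 0 ≤ θ := by rw [hθ]; positivity
  have exponent : -θ * t + 3 / 2 * θ ^ 2 * V = -(t ^ 2 / (6 * V)) := by
    rw [hθ]
    field_simp
    ring
  calc _ ≤ Real.exp (-θ * t) * mgf _ _ θ :=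
        measure_ge_le_exp_mul_mgf t hθ₀ (integrable_exp_mul_sub_weightedSum ha y hθ₀ _)
    _ ≤ Real.exp (-θ * t) * Real.exp (3 / 2 * θ ^ 2 * ((∑ r, a r ^ 2) * (y ⬝ᵥ y) ^ 2)) := by
        gcongr
        exact mgf_sub_weightedSum_le ha y hθ₀
    _ ≤ Real.exp (-θ * t) * Real.exp (3 / 2 * θ ^ 2 * V) := by gcongr
    _ = Real.exp (-(t ^ 2 / (6 * V))) := by rw [← Real.exp_add, exponent]

end LowerTail

section Net

variable {k N : ℕ}

theorem exists_int_abs_le_abs_sub_le_one (t : ℝ) : ∃ j : ℤ, |(j : ℝ)| ≤ |t| ∧ |t - j| ≤ 1 := by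
  rcases le_total 0 t with ht | ht
  · refine ⟨⌊t⌋, ?_, ?_⟩
    · rw [abs_of_nonneg ht, abs_of_nonneg (by exact_mod_cast Int.floor_nonneg.2 ht)]
      exact Int.floor_le t
    · rw [abs_le]
      constructor <;> linarith [Int.floor_le t, Int.lt_floor_add_one t]
  · refine ⟨⌈t⌉, ?_, ?_⟩
    · rw [abs_of_nonpos ht, abs_of_nonpos (by exact_mod_cast Int.ceil_le.2 (by simpa using ht))]
      exact neg_le_neg (Int.le_ceil t)
    · rw [abs_le]
      constructor <;> linarith [Int.le_ceil t, Int.ceil_lt_add_one t]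

/-- The points of the unit ball of `ℝ^k` whose coordinates are integer multiples of `1 / N`. -/
noncomputable def unitBallGrid (k N : ℕ) : Finset (Fin k → ℝ) :=
  (Fintype.piFinset fun _ => (Finset.Icc (-(N : ℤ)) N).image fun j : ℤ => (j : ℝ) / N).filter
    fun y => y ⬝ᵥ y ≤ 1

theorem dotProduct_self_le_one_of_mem_unitBallGrid {y : Fin k → ℝ} (hy : y ∈ unitBallGrid k N) :
    y ⬝ᵥ y ≤ 1 :=
  (Finset.mem_filter.1 hy).2

theorem card_unitBallGrid_le (k N : ℕ) : (unitBallGrid k N).card ≤ (2 * N + 1) ^ k := by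
  refine (Finset.card_filter_le _ _).trans ?_
  rw [Fintype.card_piFinset_const]
  refine Nat.pow_le_pow_left (Finset.card_image_le.trans_eq ?_) k
  rw [Int.card_Icc]
  omega

theorem exists_mem_unitBallGrid_near (hN : 0 < N) {x : Fin k → ℝ} (hx : x ⬝ᵥ x ≤ 1) :
    ∃ y ∈ unitBallGrid k N, (x - y) ⬝ᵥ (x - y) ≤ k / (N : ℝ) ^ 2 := by
  have hN' : (0 : ℝ) < N := by exact_mod_cast hN
  choose j hj using fun i => exists_int_abs_le_abs_sub_le_one (N * x i)
  have toward_zero (i : Fin k) : |(j i : ℝ) / N| ≤ |x i| := by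
    rw [abs_div, abs_of_pos hN', div_le_iff₀ hN']
    refine (hj i).1.trans_eq ?_
    rw [abs_mul, abs_of_pos hN', mul_comm]
  have near (i : Fin k) : |x i - j i / N| ≤ 1 / N := by
    rw [sub_div' hN'.ne', abs_div, abs_of_pos hN', mul_comm]
    gcongr
    exact (hj i).2
  have coord_le_one (i : Fin k) : |x i| ≤ 1 := by
    rw [← sq_le_one_iff_abs_le_one, sq]
    exact (Finset.single_le_sum (f := fun i => x i * x i) (fun _ _ => mul_self_nonneg _)
      (Finset.mem_univ i)).trans hx
  refine ⟨fun i => j i / N, Finset.mem_filter.2 ⟨?_, ?_⟩, ?_⟩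
  · refine Fintype.mem_piFinset.2 fun i => Finset.mem_image_of_mem _ ?_
    have bound := (toward_zero i).trans (coord_le_one i)
    rw [abs_div, abs_of_pos hN', div_le_one hN', abs_le] at bound
    exact Finset.mem_Icc.2 (by exact_mod_cast bound)
  · exact (Finset.sum_le_sum fun i _ => abs_le_iff_mul_self_le.1 (toward_zero i)).trans hx
  · calc (x - fun i => (j i : ℝ) / N) ⬝ᵥ (x - fun i => (j i : ℝ) / N)
      _ ≤ ∑ _ : Fin k, 1 / (N : ℝ) * (1 / N) := Finset.sum_le_sum fun i _ =>
          abs_le_iff_mul_self_le.1 ((near i).trans (le_abs_self _))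
      _ = k / (N : ℝ) ^ 2 := by
          rw [Finset.sum_const, Finset.card_univ, Fintype.card_fin, nsmul_eq_mul]
          ring

theorem dotProduct_mulVec_sq_le {ι κ : Type} [Fintype ι] [Fintype κ] (M : Matrix ι κ ℝ)
    (u : ι → ℝ) (v : κ → ℝ) :
    (u ⬝ᵥ M *ᵥ v) ^ 2 ≤ frobNorm M ^ 2 * ((u ⬝ᵥ u) * (v ⬝ᵥ v)) := by
  have cauchy_schwarz := Finset.sum_mul_sq_le_sq_mul_sq (Finset.univ : Finset (ι × κ))
    (fun p => M p.1 p.2) fun p => u p.1 * v p.2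
  simp only [Fintype.sum_prod_type] at cauchy_schwarz
  have form : u ⬝ᵥ M *ᵥ v = ∑ i, ∑ j, M i j * (u i * v j) := by
    simp only [dotProduct, Matrix.mulVec, Finset.mul_sum]
    exact Finset.sum_congr rfl fun i _ => Finset.sum_congr rfl fun j _ => by ring
  have norms : (u ⬝ᵥ u) * (v ⬝ᵥ v) = ∑ i, ∑ j, (u i * v j) ^ 2 := by
    simp only [dotProduct, Finset.sum_mul_sum]
    exact Finset.sum_congr rfl fun i _ => Finset.sum_congr rfl fun j _ => by ring
  rwa [form, norms, frobNorm_sq]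

theorem quadraticForm_sub_eq {κ : Type*} [Fintype κ] {M : Matrix κ κ ℝ} (hM : M.IsSymm)
    (x y : κ → ℝ) : x ⬝ᵥ M *ᵥ x - y ⬝ᵥ M *ᵥ y = (x - y) ⬝ᵥ M *ᵥ (x + y) := by
  have symm : y ⬝ᵥ M *ᵥ x = x ⬝ᵥ M *ᵥ y := by
    rw [Matrix.dotProduct_mulVec, ← Matrix.mulVec_transpose, hM.eq, dotProduct_comm]
  rw [Matrix.mulVec_add, sub_dotProduct, dotProduct_add, dotProduct_add, symm]
  ring

theorem dotProduct_add_self_le {κ : Type*} [Fintype κ] (x y : κ → ℝ) :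
    (x + y) ⬝ᵥ (x + y) ≤ 2 * (x ⬝ᵥ x) + 2 * (y ⬝ᵥ y) := by
  have parallelogram : (x + y) ⬝ᵥ (x + y) + (x - y) ⬝ᵥ (x - y) =
      2 * (x ⬝ᵥ x) + 2 * (y ⬝ᵥ y) := by
    simp only [add_dotProduct, dotProduct_add, sub_dotProduct, dotProduct_sub]
    ring
  linarith [dotProduct_self_nonneg (x - y)]

theorem quadraticForm_le_of_forall_mem_unitBallGrid {M : Matrix (Fin k) (Fin k) ℝ}
    (hM : M.IsSymm) (hN : 0 < N) {t : ℝ} (ht : ∀ y ∈ unitBallGrid k N, y ⬝ᵥ M *ᵥ y ≤ t)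
    {x : Fin k → ℝ} (hx : x ⬝ᵥ x ≤ 1) :
    x ⬝ᵥ M *ᵥ x ≤ t + 2 * frobNorm M * Real.sqrt k / N := by
  obtain ⟨y, hy, near⟩ := exists_mem_unitBallGrid_near hN hx
  have sum_le : (x + y) ⬝ᵥ (x + y) ≤ 4 := by
    linarith [dotProduct_add_self_le x y, dotProduct_self_le_one_of_mem_unitBallGrid hy]
  have diff_sq : (x ⬝ᵥ M *ᵥ x - y ⬝ᵥ M *ᵥ y) ^ 2 ≤ (2 * frobNorm M * Real.sqrt k / N) ^ 2 := by
    calc (x ⬝ᵥ M *ᵥ x - y ⬝ᵥ M *ᵥ y) ^ 2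
      _ ≤ frobNorm M ^ 2 * ((x - y) ⬝ᵥ (x - y) * (x + y) ⬝ᵥ (x + y)) := by
          rw [quadraticForm_sub_eq hM]
          exact dotProduct_mulVec_sq_le M (x - y) (x + y)
      _ ≤ frobNorm M ^ 2 * (k / (N : ℝ) ^ 2 * 4) := by
          gcongr
          exact dotProduct_self_nonneg _
      _ = (2 * frobNorm M * Real.sqrt k / N) ^ 2 := by
          rw [div_pow, mul_pow, mul_pow, Real.sq_sqrt k.cast_nonneg]
          ring
  have nonneg : 0 ≤ 2 * frobNorm M * Real.sqrt k / N := by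
    have := frobNorm_nonneg M
    positivity
  linarith [ht y hy, abs_le_of_sq_le_sq diff_sq nonneg, le_abs_self (x ⬝ᵥ M *ᵥ x - y ⬝ᵥ M *ᵥ y)]

end Net

section SketchDeviation

variable {d : ℕ} {κ : Type} [DecidableEq κ]

/-- The deviation of the sketch of a diagonal matrix from its mean, the trace times the identity.
Its sign is chosen so that an upper bound on its quadratic form is a lower bound on the smallest
eigenvalue of the sketch. -/
noncomputable def sketchDeviation (a : Fin d → ℝ) (Y : Matrix (Fin d) κ ℝ) : Matrix κ κ ℝ :=
  (∑ r, a r) • (1 : Matrix κ κ ℝ) - bilinearSketch (Matrix.diagonal a) Y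

theorem isSymm_sketchDeviation (a : Fin d → ℝ) (Y : Matrix (Fin d) κ ℝ) :
    (sketchDeviation a Y).IsSymm :=
  (Matrix.isSymm_one.smul _).sub <| Matrix.isHermitian_iff_isSymm.1 <|
    isHermitian_bilinearSketch
      (Matrix.isHermitian_iff_isSymm.2 (Matrix.isSymm_diagonal a)) Y

variable [Fintype κ]

theorem dotProduct_sketchDeviation (a : Fin d → ℝ) (Y : Matrix (Fin d) κ ℝ) (x : κ → ℝ) :
    x ⬝ᵥ sketchDeviation a Y *ᵥ x = (∑ r, a r) * (x ⬝ᵥ x) - ∑ r, a r * (Y r ⬝ᵥ x) ^ 2 := by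
  rw [sketchDeviation, Matrix.sub_mulVec, dotProduct_sub, dotProduct_bilinearSketch_diagonal,
    Matrix.smul_mulVec, Matrix.one_mulVec, dotProduct_smul, smul_eq_mul]

theorem sketchDeviation_apply (a : Fin d → ℝ) (Y : Matrix (Fin d) κ ℝ) (i j : κ) :
    sketchDeviation a Y i j = (∑ r, a r) * (Pi.single i 1 ⬝ᵥ Pi.single j 1) -
      ∑ r, a r * (Y r ⬝ᵥ Pi.single i 1 * Y r ⬝ᵥ Pi.single j 1) := by
  simp only [sketchDeviation, Matrix.sub_apply, Matrix.smul_apply, smul_eq_mul,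
    bilinearSketch_diagonal_apply, dotProduct_single_one, Matrix.one_apply, Pi.single_apply,
    eq_comm]

theorem memLp_sketchDeviation_apply (a : Fin d → ℝ) (i j : κ) :
    MemLp (fun Y => sketchDeviation a Y i j) 2 (gaussianMatrix d κ) := by
  simp_rw [sketchDeviation_apply]
  exact (memLp_const _).sub (memLp_weightedSum_pi
    (memLp_dotProduct_mul_dotProduct (Pi.single i (1 : ℝ)) (Pi.single j 1)) a)

theorem integral_sketchDeviation_apply_sq_le (a : Fin d → ℝ) (i j : κ) :
    ∫ Y, sketchDeviation a Y i j ^ 2 ∂(gaussianMatrix d κ) ≤ 3 * ∑ r, a r ^ 2 := by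
  obtain ⟨u, hu⟩ : ∃ u : κ → ℝ, u = Pi.single i 1 := ⟨_, rfl⟩
  obtain ⟨v, hv⟩ : ∃ v : κ → ℝ, v = Pi.single j 1 := ⟨_, rfl⟩
  have memLp := memLp_dotProduct_mul_dotProduct u v
  have mean : ∫ Y, ∑ r, a r * (Y r ⬝ᵥ u * Y r ⬝ᵥ v) ∂(Measure.pi fun _ : Fin d => stdPi κ) =
      (∑ r, a r) * (u ⬝ᵥ v) := by
    rw [integral_weightedSum_pi (memLp.integrable one_le_two), integral_dotProduct_mul_dotProduct]
  calc ∫ Y, sketchDeviation a Y i j ^ 2 ∂(gaussianMatrix d κ)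
    _ = Var[fun Y => ∑ r, a r * (Y r ⬝ᵥ u * Y r ⬝ᵥ v); Measure.pi fun _ : Fin d => stdPi κ] := by
        rw [variance_eq_integral (memLp_weightedSum_pi memLp a).aemeasurable, mean]
        simp_rw [sketchDeviation_apply, ← hu, ← hv, sub_sq_comm ((∑ r, a r) * (u ⬝ᵥ v))]
        rfl
    _ ≤ (∑ r, a r ^ 2) * (3 / 2 * ((u ⬝ᵥ u) ^ 2 + (v ⬝ᵥ v) ^ 2)) := by
        rw [variance_weightedSum_pi memLp]
        gcongr
        exact variance_dotProduct_mul_dotProduct_le u v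
    _ = 3 * ∑ r, a r ^ 2 := by
        rw [hu, hv, dotProduct_single_one, dotProduct_single_one, Pi.single_eq_same,
          Pi.single_eq_same]
        ring

theorem real_le_frobNorm_sketchDeviation_le (a : Fin d → ℝ) {s : ℝ} (hs : 0 < s) :
    (gaussianMatrix d κ).real {Y | s ≤ frobNorm (sketchDeviation a Y)} ≤
      3 * Fintype.card κ ^ 2 * (∑ r, a r ^ 2) / s ^ 2 := by
  have integrable (i j : κ) :
      Integrable (fun Y => sketchDeviation a Y i j ^ 2) (gaussianMatrix d κ) :=
    (memLp_sketchDeviation_apply a i j).integrable_sq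
  have markov := mul_meas_ge_le_integral_of_nonneg (μ := gaussianMatrix d κ)
    (f := fun Y => ∑ i, ∑ j, sketchDeviation a Y i j ^ 2)
    (.of_forall fun Y => by positivity)
    (integrable_finsetSum _ fun i _ => integrable_finsetSum _ fun j _ => integrable i j) (s ^ 2)
  have mean : ∫ Y, ∑ i, ∑ j, sketchDeviation a Y i j ^ 2 ∂(gaussianMatrix d κ) ≤
      3 * Fintype.card κ ^ 2 * ∑ r, a r ^ 2 := by
    simp_rw [integral_finsetSum _ fun i _ => integrable_finsetSum _ fun j _ => integrable i j,
      integral_finsetSum _ fun j _ => integrable _ j]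
    refine (Finset.sum_le_sum fun i _ => Finset.sum_le_sum fun j _ =>
      integral_sketchDeviation_apply_sq_le a i j).trans_eq ?_
    rw [Finset.sum_const, Finset.sum_const, Finset.card_univ, nsmul_eq_mul, nsmul_eq_mul]
    ring
  rw [le_div_iff₀' (by positivity)]
  refine le_trans (mul_le_mul_of_nonneg_left (measureReal_mono (fun Y (large : s ≤ _) => ?_)
    (measure_ne_top _ _)) (sq_nonneg s)) (markov.trans mean)
  rw [Set.mem_ofPred_eq, ← frobNorm_sq]
  gcongr

end SketchDeviation

section PSDInputs

variable {d k : ℕ}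

theorem real_exists_mem_unitBallGrid_le {a : Fin d → ℝ} (ha : ∀ r, 0 ≤ a r) (N : ℕ) {V t : ℝ}
    (hV : 0 < V) (haV : ∑ r, a r ^ 2 ≤ V) (ht : 0 ≤ t) :
    (gaussianMatrix d (Fin k)).real
      {Y | ∃ y ∈ unitBallGrid k N, t ≤ y ⬝ᵥ sketchDeviation a Y *ᵥ y} ≤
      (2 * N + 1) ^ k * Real.exp (-(t ^ 2 / (6 * V))) := by
  have point {y : Fin k → ℝ} (hy : y ∈ unitBallGrid k N) :
      (gaussianMatrix d (Fin k)).real {Y | t ≤ y ⬝ᵥ sketchDeviation a Y *ᵥ y} ≤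
        Real.exp (-(t ^ 2 / (6 * V))) := by
    simp only [dotProduct_sketchDeviation]
    refine real_le_sub_weightedSum_le ha y hV ?_ ht
    refine (mul_le_of_le_one_right (by positivity) ?_).trans haV
    exact pow_le_one₀ (dotProduct_self_nonneg y) (dotProduct_self_le_one_of_mem_unitBallGrid hy)
  simp only [← exists_prop, Set.ofPred_exists]
  refine (measureReal_biUnion_finset_le _ _).trans
    ((Finset.sum_le_card_nsmul _ _ _ fun y hy => point hy).trans ?_)
  rw [nsmul_eq_mul]
  gcongr
  exact_mod_cast card_unitBallGrid_le k N

theorem sum_sub_le_lambdaMin_bilinearSketch (hk : 0 < k) (a : Fin d → ℝ)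
    (Y : Matrix (Fin d) (Fin k) ℝ) {N : ℕ} (hN : 0 < N) {s t : ℝ}
    (hs : frobNorm (sketchDeviation a Y) ≤ s)
    (ht : ∀ y ∈ unitBallGrid k N, y ⬝ᵥ sketchDeviation a Y *ᵥ y ≤ t) :
    ∑ r, a r - (t + 2 * s * Real.sqrt k / N) ≤
      lambdaMin (bilinearSketch (Matrix.diagonal a) Y) := by
  have : Nonempty (Fin k) := ⟨⟨0, hk⟩⟩
  obtain ⟨x, hx, form_eq⟩ := exists_unit_quadraticForm_eq_lambdaMin
    (isHermitian_bilinearSketch (Matrix.isHermitian_iff_isSymm.2 (Matrix.isSymm_diagonal a)) Y)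
  have form_le := quadraticForm_le_of_forall_mem_unitBallGrid (isSymm_sketchDeviation a Y) hN ht
    hx.le
  rw [dotProduct_sketchDeviation, ← dotProduct_bilinearSketch_diagonal, form_eq, hx, mul_one]
    at form_le
  have : 2 * frobNorm (sketchDeviation a Y) * Real.sqrt k / N ≤ 2 * s * Real.sqrt k / N := by gcongr
  linarith

theorem one_le_log_of_three_le (hk : 3 ≤ k) : 1 ≤ Real.log k := by
  have hk' : (3 : ℝ) ≤ k := by exact_mod_cast hk
  rw [Real.le_log_iff_exp_le (by positivity)]
  linarith [Real.exp_one_lt_three]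

theorem pow_mul_exp_neg_le (hk : 3 ≤ k) :
    (2 * (k : ℝ) + 1) ^ k * Real.exp (-(6 * (k * Real.log k ^ 2))) ≤ 0.01 := by
  have hk' : (3 : ℝ) ≤ k := by exact_mod_cast hk
  have log_ge := one_le_log_of_three_le hk
  have base : 2 * (k : ℝ) + 1 ≤ Real.exp (2 * Real.log k) := by
    rw [two_mul (Real.log k), Real.exp_add, Real.exp_log (by linarith)]
    nlinarith
  calc (2 * (k : ℝ) + 1) ^ k * Real.exp (-(6 * (k * Real.log k ^ 2)))
    _ ≤ Real.exp (2 * Real.log k) ^ k * Real.exp (-(6 * (k * Real.log k ^ 2))) := by gcongr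
    _ = Real.exp (2 * k * (Real.log k - 3 * Real.log k ^ 2)) := by
        rw [← Real.exp_nat_mul, ← Real.exp_add]
        ring_nf
    _ ≤ Real.exp (-5) := by
        have factor_ge : 2 ≤ 3 * Real.log k ^ 2 - Real.log k := by nlinarith
        gcongr
        nlinarith
    _ ≤ 0.01 := by
        have exp_five : Real.exp 5 = Real.exp 1 ^ 5 := by rw [Real.exp_one_pow, Nat.cast_ofNat]
        rw [Real.exp_neg, inv_le_comm₀ (Real.exp_pos 5) (by norm_num), exp_five]
        calc (0.01 : ℝ)⁻¹ ≤ 2.7 ^ 5 := by norm_num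
          _ ≤ Real.exp 1 ^ 5 := by
            gcongr
            linarith [Real.exp_one_gt_d9]

theorem real_lambdaMin_diagonal_lt_le (hk : 3 ≤ k) {a : Fin d → ℝ} (ha : ∀ r, 0 ≤ a r) {F : ℝ}
    (hF : 0 < F) (haF : ∑ r, a r ^ 2 = F ^ 2) :
    (gaussianMatrix d (Fin k)).real
      {Y | lambdaMin (bilinearSketch (Matrix.diagonal a) Y) <
        ∑ r, a r - 36 * (Real.sqrt k * Real.log k) * F} ≤ 0.03 := by
  have : (0 : ℝ) < k := by positivity
  have log_ge := one_le_log_of_three_le hk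
  have norm_large : (gaussianMatrix d (Fin k)).real
      {Y | 15 * k * F ≤ frobNorm (sketchDeviation a Y)} ≤ 0.02 := by
    refine (real_le_frobNorm_sketchDeviation_le a (by positivity)).trans ?_
    rw [haF, Fintype.card_fin, div_le_iff₀ (by positivity)]
    nlinarith [sq_nonneg (k * F)]
  have grid_large : (gaussianMatrix d (Fin k)).real {Y | ∃ y ∈ unitBallGrid k k,
      6 * (Real.sqrt k * Real.log k) * F ≤ y ⬝ᵥ sketchDeviation a Y *ᵥ y} ≤ 0.01 := by
    refine (real_exists_mem_unitBallGrid_le ha k (pow_pos hF 2) haF.le (by positivity)).trans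
      (le_of_eq_of_le ?_ (pow_mul_exp_neg_le hk))
    rw [mul_pow, mul_pow, mul_pow, Real.sq_sqrt k.cast_nonneg]
    congr 3
    field_simp
  refine (measureReal_mono (fun Y hY => ?_) (measure_ne_top _ _)).trans
    ((measureReal_union_le _ _).trans ((add_le_add norm_large grid_large).trans (by norm_num)))
  by_contra good
  simp only [Set.mem_union, Set.mem_ofPred_eq, not_or, not_le, not_exists, not_and] at good
  have bound := sum_sub_le_lambdaMin_bilinearSketch (by omega) a Y (by omega : 0 < k) good.1.le
    fun y hy => (good.2 y hy).le
  have cancel : 2 * (15 * k * F) * Real.sqrt k / k = 30 * Real.sqrt k * F := by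
    field_simp
    norm_num
  have : 30 * Real.sqrt k * F ≤ 30 * (Real.sqrt k * Real.log k) * F := by
    gcongr
    exact le_mul_of_one_le_right (Real.sqrt_nonneg _) log_ge
  refine absurd hY (not_lt.2 (le_trans ?_ bound))
  linarith

theorem real_lambdaMin_bilinearSketch_lt_le (hk : 3 ≤ k) {A : Matrix (Fin d) (Fin d) ℝ}
    (hA : A.PosSemidef) :
    (gaussianMatrix d (Fin k)).real
      {G | lambdaMin (bilinearSketch A G) <
        A.trace - 36 * (Real.sqrt k * Real.log k) * frobNorm A} ≤ 0.03 := by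
  have : Nonempty (Fin k) := ⟨⟨0, by omega⟩⟩
  rcases eq_or_ne A 0 with rfl | nonzero
  · have sketch_psd (G : Matrix (Fin d) (Fin k) ℝ) :
        0 ≤ lambdaMin (bilinearSketch (0 : Matrix (Fin d) (Fin d) ℝ) G) := by
      rw [← posSemidef_iff_lambdaMin_nonneg (isHermitian_bilinearSketch hA.isHermitian G)]
      exact hA.conjTranspose_mul_mul_same G
    have norm_zero : frobNorm (0 : Matrix (Fin d) (Fin d) ℝ) = 0 := by simp [frobNorm]
    simp only [norm_zero, Matrix.trace_zero, mul_zero, sub_zero, (sketch_psd _).not_gt,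
      Set.ofPred_false, measureReal_empty]
    norm_num
  · refine (real_bilinearSketch_mem_le_diagonal_eigenvalues hA.isHermitian
      {S | lambdaMin S < A.trace - 36 * (Real.sqrt k * Real.log k) * frobNorm A}).trans ?_
    rw [trace_eq_sum_eigenvalues hA.isHermitian]
    exact real_lambdaMin_diagonal_lt_le hk hA.eigenvalues_nonneg (frobNorm_pos nonzero)
      (frobNorm_sq_eq_sum_eigenvalues_sq hA.isHermitian).symm

end PSDInputs

section FarInputs

variable {d k : ℕ}

theorem real_dotProduct_self_lt_half_le (hk : 0 < k) :
    (stdPi (Fin k)).real {g | g ⬝ᵥ g < k / 2} ≤ 8 / k := by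
  have chebyshev := measureReal_lt_abs_sub_integral_le (c := 8 / k) (t := k / 2)
    (memLp_dotProduct_self (κ := Fin k)) (by positivity) (by positivity) (by
      rw [variance_dotProduct_self, Fintype.card_fin]
      field_simp
      norm_num)
  rw [integral_dotProduct_self, Fintype.card_fin] at chebyshev
  refine (measureReal_mono fun g (small : g ⬝ᵥ g < _) => ?_).trans chebyshev
  rw [Set.mem_ofPred_eq, lt_abs]
  right
  linarith

theorem real_weightedSum_dotProduct_sq_deviation_le {ι κ : Type*} [Fintype ι] [Fintype κ]
    {a : ι → ℝ} {F : ℝ} (hF : 0 ≤ F) (haF : ∑ r, a r ^ 2 ≤ F ^ 2) (g : κ → ℝ) :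
    (Measure.pi fun _ : ι => stdPi κ).real {R | 15 * F * (g ⬝ᵥ g) <
      |∑ r, a r * (R r ⬝ᵥ g) ^ 2 - (∑ r, a r) * (g ⬝ᵥ g)|} ≤ 0.01 := by
  have chebyshev := measureReal_lt_abs_sub_integral_le (c := 0.01) (t := 15 * F * (g ⬝ᵥ g))
    (memLp_weightedSum_pi (memLp_dotProduct_sq g) a) (by norm_num)
    (mul_nonneg (by positivity) (dotProduct_self_nonneg g)) (by
      rw [variance_weightedSum_pi (memLp_dotProduct_sq g), variance_dotProduct_sq]
      nlinarith [mul_le_mul_of_nonneg_right haF (sq_nonneg (g ⬝ᵥ g)),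
        mul_nonneg (sq_nonneg F) (sq_nonneg (g ⬝ᵥ g))])
  rwa [integral_weightedSum_pi (integrable_dotProduct_pow g 2), integral_dotProduct_sq] at chebyshev

-- Conditionally on row `i`, the remaining rows are independent and standard Gaussian.
theorem real_weightedSum_succAbove_deviation_le {κ : Type} [Fintype κ] (i : Fin (d + 1))
    {a : Fin (d + 1) → ℝ} {F : ℝ} (hF : 0 ≤ F) (haF : ∑ r, a r ^ 2 ≤ F ^ 2) :
    (gaussianMatrix (d + 1) κ).real {Y | 15 * F * (Y i ⬝ᵥ Y i) <
      |∑ j, a (i.succAbove j) * (Y (i.succAbove j) ⬝ᵥ Y i) ^ 2 -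
        (∑ j, a (i.succAbove j)) * (Y i ⬝ᵥ Y i)|} ≤ 0.01 := by
  have split := measurePreserving_piFinSuccAbove (fun _ : Fin (d + 1) => stdPi κ) i
  have haF' : ∑ j, a (i.succAbove j) ^ 2 ≤ F ^ 2 := by
    rw [Fin.sum_univ_succAbove _ i] at haF
    linarith [sq_nonneg (a i)]
  let bad : Set ((κ → ℝ) × (Fin d → κ → ℝ)) := {p | 15 * F * (p.1 ⬝ᵥ p.1) <
    |∑ j, a (i.succAbove j) * (p.2 j ⬝ᵥ p.1) ^ 2 - (∑ j, a (i.succAbove j)) * (p.1 ⬝ᵥ p.1)|}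
  have measurable_bad : MeasurableSet bad := by
    unfold bad dotProduct
    exact measurableSet_lt (by fun_prop) (by fun_prop)
  refine ENNReal.toReal_le_of_le_ofReal (by norm_num)
    ((split.measure_preimage_le bad).trans ?_)
  calc ((stdPi κ).prod (Measure.pi fun _ => stdPi κ)) bad
    _ = ∫⁻ g, (Measure.pi fun _ => stdPi κ) (Prod.mk g ⁻¹' bad) ∂(stdPi κ) :=
        Measure.prod_apply measurable_bad
    _ ≤ ∫⁻ _, ENNReal.ofReal 0.01 ∂(stdPi κ) := lintegral_mono fun g =>
        (ENNReal.le_ofReal_iff_toReal_le (measure_ne_top _ _) (by norm_num)).2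
          (real_weightedSum_dotProduct_sq_deviation_le hF haF' g)
    _ = ENNReal.ofReal 0.01 := by rw [lintegral_const, measure_univ, mul_one]

theorem lambdaMin_bilinearSketch_diagonal_le {κ : Type} [Fintype κ] [DecidableEq κ]
    (a : Fin (d + 1) → ℝ) (Y : Matrix (Fin (d + 1)) κ ℝ) (i : Fin (d + 1)) {b : ℝ}
    (hY : 0 < Y i ⬝ᵥ Y i)
    (hb : |∑ j, a (i.succAbove j) * (Y (i.succAbove j) ⬝ᵥ Y i) ^ 2 -
      (∑ j, a (i.succAbove j)) * (Y i ⬝ᵥ Y i)| ≤ b * (Y i ⬝ᵥ Y i)) :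
    lambdaMin (bilinearSketch (Matrix.diagonal a) Y) ≤ ∑ r, a r + a i * (Y i ⬝ᵥ Y i - 1) + b := by
  have rayleigh := lambdaMin_mul_le (isHermitian_bilinearSketch
    (Matrix.isHermitian_iff_isSymm.2 (Matrix.isSymm_diagonal a)) Y) (Y i)
  rw [dotProduct_bilinearSketch_diagonal, Fin.sum_univ_succAbove _ i] at rayleigh
  rw [Fin.sum_univ_succAbove _ i]
  refine le_of_mul_le_mul_right ?_ hY
  linarith [le_of_abs_le hb]

theorem real_le_lambdaMin_diagonal_le (hk : 2 ≤ k) {a : Fin d → ℝ} {F ε : ℝ} (hF : 0 < F)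
    (haF : ∑ r, a r ^ 2 = F ^ 2) (hε : 0 < ε) (hε₁ : ε < 1) {i : Fin d} (hi : a i ≤ -(ε * F)) :
    (gaussianMatrix d (Fin k)).real {Y | ∑ r, a r + (16 - ε * k / 2) * F ≤
      lambdaMin (bilinearSketch (Matrix.diagonal a) Y)} ≤ 8 / k + 0.01 := by
  obtain ⟨d, rfl⟩ : ∃ n, d = n + 1 := Nat.exists_eq_succ_of_ne_zero i.pos.ne'
  have hk' : (2 : ℝ) ≤ k := by exact_mod_cast hk
  have short_row : (gaussianMatrix (d + 1) (Fin k)).real {Y | Y i ⬝ᵥ Y i < k / 2} ≤ 8 / k :=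
    (measureReal_preimage_le (measurePreserving_row (Fin k) i) {g | g ⬝ᵥ g < k / 2}).trans
      (real_dotProduct_self_lt_half_le (by omega))
  refine (measureReal_mono (fun Y hY => ?_) (measure_ne_top _ _)).trans
    ((measureReal_union_le _ _).trans (add_le_add short_row
      (real_weightedSum_succAbove_deviation_le i hF.le haF.le)))
  by_contra good
  simp only [Set.mem_union, Set.mem_ofPred_eq, not_or, not_lt] at good
  obtain ⟨long_row, deviation⟩ := good
  have bound := lambdaMin_bilinearSketch_diagonal_le a Y i (by linarith) deviation
  have row_term : a i * (Y i ⬝ᵥ Y i - 1) ≤ -(ε * F) * (k / 2 - 1) := by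
    calc a i * (Y i ⬝ᵥ Y i - 1) ≤ -(ε * F) * (Y i ⬝ᵥ Y i - 1) := by
          gcongr
          linarith
      _ ≤ -(ε * F) * (k / 2 - 1) := by
          refine mul_le_mul_of_nonpos_left (by linarith) ?_
          linarith [mul_pos hε hF]
  have : ε * F < F := mul_lt_of_lt_one_left hF hε₁
  refine absurd hY (not_le.2 (bound.trans_lt ?_))
  linarith

theorem real_le_lambdaMin_bilinearSketch_le (hk : 2 ≤ k) {A : Matrix (Fin d) (Fin d) ℝ} {ε : ℝ}
    (hA : A.IsHermitian) (hε : 0 < ε) (hε₁ : ε < 1) (hfar : IsFarFromPSD ε A) :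
    (gaussianMatrix d (Fin k)).real {G | A.trace + (16 - ε * k / 2) * frobNorm A ≤
      lambdaMin (bilinearSketch A G)} ≤ 8 / k + 0.01 := by
  obtain ⟨nonzero, lambdaMin_le⟩ := hfar
  have : Nonempty (Fin d) := by
    by_contra empty
    rw [not_nonempty_iff] at empty
    exact nonzero (Subsingleton.elim _ _)
  obtain ⟨i, hi⟩ := exists_eigenvalue_eq_lambdaMin hA
  refine (real_bilinearSketch_mem_le_diagonal_eigenvalues hA
    {S | A.trace + (16 - ε * k / 2) * frobNorm A ≤ lambdaMin S}).trans ?_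
  rw [trace_eq_sum_eigenvalues hA]
  exact real_le_lambdaMin_diagonal_le hk (frobNorm_pos nonzero)
    (frobNorm_sq_eq_sum_eigenvalues_sq hA).symm hε hε₁ (hi.trans_le lambdaMin_le)

end FarInputs

section Measurability

variable {d : ℕ} {κ : Type} {A : Matrix (Fin d) (Fin d) ℝ}

theorem measurable_bilinearSketch (A : Matrix (Fin d) (Fin d) ℝ) :
    Measurable fun G : Matrix (Fin d) κ ℝ => bilinearSketch A G := by
  refine measurable_pi_lambda _ fun i => measurable_pi_lambda _ fun j => ?_
  simp only [bilinearSketch, Matrix.mul_apply, Matrix.transpose_apply]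
  exact Finset.measurable_sum _ fun r _ => (Finset.measurable_sum _ fun s _ =>
    (measurable_entry s i).mul_const _).mul (measurable_entry r j)

theorem measurable_lambdaMin_bilinearSketch [Fintype κ] [DecidableEq κ] [Nonempty κ]
    (hA : A.IsHermitian) :
    Measurable fun G : Matrix (Fin d) κ ℝ => lambdaMin (bilinearSketch A G) := by
  refine measurable_of_Ici fun c => ?_
  have isClosed : IsClosed {G : Fin d → κ → ℝ | ∀ x : κ → ℝ,
      c * (x ⬝ᵥ x) ≤ x ⬝ᵥ bilinearSketch A (G : Matrix (Fin d) κ ℝ) *ᵥ x} := by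
    rw [Set.ofPred_forall]
    refine isClosed_iInter fun x => isClosed_le continuous_const ?_
    simp only [bilinearSketch, dotProduct, Matrix.mulVec]
    fun_prop
  have preimage : (fun G : Matrix (Fin d) κ ℝ => lambdaMin (bilinearSketch A G)) ⁻¹' Set.Ici c =
      {G : Fin d → κ → ℝ | ∀ x : κ → ℝ,
        c * (x ⬝ᵥ x) ≤ x ⬝ᵥ bilinearSketch A (G : Matrix (Fin d) κ ℝ) *ᵥ x} :=
    Set.ext fun G => le_lambdaMin_iff (isHermitian_bilinearSketch hA G) c
  rw [preimage]
  exact isClosed.measurableSet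

end Measurability

section Columns

variable (d : ℕ) (κ κ' : Type) [Fintype κ] [Fintype κ']

theorem measurePreserving_toCols₁ :
    MeasurePreserving (Matrix.toCols₁ : Matrix (Fin d) (κ ⊕ κ') ℝ → Matrix (Fin d) κ ℝ)
      (gaussianMatrix d (κ ⊕ κ')) (gaussianMatrix d κ) :=
  measurePreserving_pi (fun _ : Fin d => stdPi (κ ⊕ κ')) (fun _ => stdPi κ) fun _ =>
    measurePreserving_fst.comp
      (measurePreserving_sumPiEquivProdPi fun _ : κ ⊕ κ' => gaussianReal 0 1)

theorem measurePreserving_toCols₂ :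
    MeasurePreserving (Matrix.toCols₂ : Matrix (Fin d) (κ ⊕ κ') ℝ → Matrix (Fin d) κ' ℝ)
      (gaussianMatrix d (κ ⊕ κ')) (gaussianMatrix d κ') :=
  measurePreserving_pi (fun _ : Fin d => stdPi (κ ⊕ κ')) (fun _ => stdPi κ') fun _ =>
    measurePreserving_snd.comp
      (measurePreserving_sumPiEquivProdPi fun _ : κ ⊕ κ' => gaussianReal 0 1)

end Columns

section GammaStat

variable {k : ℕ} {S : Matrix (Fin k) (Fin k) ℝ} {F τ α β : ℝ}

theorem one_le_sqrt_mul_log (hk : 3 ≤ k) : 1 ≤ Real.sqrt k * Real.log k :=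
  one_le_mul_of_one_le_of_one_le (Real.one_le_sqrt.2 (by exact_mod_cast (by omega : 1 ≤ k)))
    (one_le_log_of_three_le hk)

theorem gammaStat_eq_div (α β : ℝ) (S : Matrix (Fin k) (Fin k) ℝ) :
    gammaStat α β S = (α - lambdaMin S) / (β * (Real.sqrt k * Real.log k)) := by
  rw [gammaStat, mul_assoc]

theorem gammaStat_le (hk : 3 ≤ k) (hα : |α - τ| ≤ F) (hβ : F / 2 ≤ β)
    (hS : τ - 36 * (Real.sqrt k * Real.log k) * F ≤ lambdaMin S) : gammaStat α β S ≤ 74 := by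
  have hF : 0 ≤ F := (abs_nonneg _).trans hα
  have scale := one_le_sqrt_mul_log hk
  rw [gammaStat_eq_div]
  set u := Real.sqrt k * Real.log k
  refine div_le_of_le_mul₀ (mul_nonneg (by linarith) (by linarith)) (by norm_num) ?_
  calc α - lambdaMin S ≤ F + 36 * u * F := by linarith [le_of_abs_le hα]
    _ ≤ 74 * (F / 2 * u) := by linarith [mul_le_mul_of_nonneg_right scale hF]
    _ ≤ 74 * (β * u) := by gcongr

theorem lt_gammaStat {ε : ℝ} (hk : 3 ≤ k) (hkε : 330 * (Real.sqrt k * Real.log k) < ε * k)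
    (hF : 0 < F) (hα : |α - τ| ≤ F) (hβ : F / 2 ≤ β ∧ β ≤ 2 * F)
    (hS : lambdaMin S < τ + (16 - ε * k / 2) * F) : 74 < gammaStat α β S := by
  have scale := one_le_sqrt_mul_log hk
  rw [gammaStat_eq_div]
  set u := Real.sqrt k * Real.log k
  rw [lt_div_iff₀ (mul_pos (by linarith [hβ.1]) (by linarith))]
  calc 74 * (β * u) ≤ 74 * (2 * F * u) := by gcongr; exact hβ.2
    _ = 165 * u * F - 17 * u * F := by ring
    _ ≤ ε * k / 2 * F - 17 * 1 * F := by gcongr; linarith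
    _ < α - lambdaMin S := by linarith [neg_le_of_abs_le hα]

end GammaStat

section Tester

variable {d k m : ℕ} {A : Matrix (Fin d) (Fin d) ℝ} {trEst frEst : Matrix (Fin m) (Fin m) ℝ → ℝ}

theorem measurableSet_sketchAccepts (hk : 0 < k) (htr : Measurable trEst) (hfr : Measurable frEst)
    (c : ℝ) (hA : A.IsHermitian) :
    MeasurableSet {X : Matrix (Fin d) (Fin k ⊕ Fin m) ℝ |
      sketchAccepts trEst frEst c (bilinearSketch A X)} := by
  have : Nonempty (Fin k) := ⟨⟨0, hk⟩⟩
  have measurable_lambdaMin := (measurable_lambdaMin_bilinearSketch hA).comp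
    (measurePreserving_toCols₁ d (Fin k) (Fin m)).measurable
  have measurable_estimates := (measurable_bilinearSketch A).comp
    (measurePreserving_toCols₂ d (Fin k) (Fin m)).measurable
  have accepts_eq : {X : Matrix (Fin d) (Fin k ⊕ Fin m) ℝ |
      sketchAccepts trEst frEst c (bilinearSketch A X)} =
      {X | 0 ≤ lambdaMin (bilinearSketch A X.toCols₁)} ∩
      {X | gammaStat (trEst (bilinearSketch A X.toCols₂)) (frEst (bilinearSketch A X.toCols₂))
        (bilinearSketch A X.toCols₁) ≤ c} := by
    ext X
    exact and_congr_left'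
      (posSemidef_iff_lambdaMin_nonneg (isHermitian_bilinearSketch hA X.toCols₁))
  rw [accepts_eq]
  exact (measurableSet_le measurable_const measurable_lambdaMin).inter (measurableSet_le
    (((htr.comp measurable_estimates).sub measurable_lambdaMin).div
      (((hfr.comp measurable_estimates).mul_const _).mul_const _)) measurable_const)

theorem le_real_sketch_of_bad_events {bad : Set (Matrix (Fin d) (Fin k) ℝ)}
    {badTr badFr : Set (Matrix (Fin d) (Fin m) ℝ)} {good : Set (Matrix (Fin d) (Fin k ⊕ Fin m) ℝ)}
    {δ δtr δfr p : ℝ} (hbad : (gaussianMatrix d (Fin k)).real bad ≤ δ)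
    (htr : (gaussianMatrix d (Fin m)).real badTr ≤ δtr)
    (hfr : (gaussianMatrix d (Fin m)).real badFr ≤ δfr) (hp : p ≤ 1 - (δ + (δtr + δfr)))
    (hgood : ∀ X : Matrix (Fin d) (Fin k ⊕ Fin m) ℝ,
      X.toCols₁ ∉ bad → X.toCols₂ ∉ badTr → X.toCols₂ ∉ badFr → X ∈ good) :
    p ≤ (gaussianMatrix d (Fin k ⊕ Fin m)).real good := by
  have bad_le : (gaussianMatrix d (Fin k ⊕ Fin m)).real (Matrix.toCols₁ ⁻¹' bad) ≤ δ :=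
    (measureReal_preimage_le (measurePreserving_toCols₁ d (Fin k) (Fin m)) bad).trans hbad
  have estimates_bad_le : (gaussianMatrix d (Fin k ⊕ Fin m)).real
      (Matrix.toCols₂ ⁻¹' (badTr ∪ badFr)) ≤ δtr + δfr :=
    (measureReal_preimage_le (measurePreserving_toCols₂ d (Fin k) (Fin m)) _).trans
      ((measureReal_union_le _ _).trans (add_le_add htr hfr))
  refine le_measureReal_of_notMem
    ((measureReal_union_le _ _).trans (add_le_add bad_le estimates_bad_le)) hp fun X hX => ?_
  simp only [Set.mem_union, Set.mem_preimage, not_or] at hX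
  exact hgood X hX.1 hX.2.1 hX.2.2

section Correctness

variable (htr : (gaussianMatrix d (Fin m)).real
    {H | frobNorm A < |trEst (bilinearSketch A H) - A.trace|} ≤ 0.01)
  (hfr : (gaussianMatrix d (Fin m)).real
    {H | ¬(frobNorm A / 2 ≤ frEst (bilinearSketch A H) ∧
      frEst (bilinearSketch A H) ≤ 2 * frobNorm A)} ≤ 0.01)

include htr hfr

theorem le_real_sketchAccepts_of_posSemidef (hk : 3 ≤ k) (hA : A.PosSemidef) :
    0.9 ≤ (gaussianMatrix d (Fin k ⊕ Fin m)).real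
      {X | sketchAccepts trEst frEst 74 (bilinearSketch A X)} := by
  refine le_real_sketch_of_bad_events (real_lambdaMin_bilinearSketch_lt_le hk hA) htr hfr
    (by norm_num) fun X hlambda htrace hfrob => ⟨?_, ?_⟩
  · exact hA.conjTranspose_mul_mul_same X.toCols₁
  · exact gammaStat_le hk (not_lt.1 htrace) (not_not.1 hfrob).1 (not_lt.1 hlambda)

theorem le_real_not_sketchAccepts_of_isFarFromPSD (hk : 1000 ≤ k) (hA : A.IsHermitian) {ε : ℝ}
    (hε : 0 < ε) (hε₁ : ε < 1) (hkε : 330 * (Real.sqrt k * Real.log k) < ε * k)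
    (hfar : IsFarFromPSD ε A) :
    0.9 ≤ (gaussianMatrix d (Fin k ⊕ Fin m)).real
      {X | sketchAccepts trEst frEst 74 (bilinearSketch A X)}ᶜ := by
  have k_large : (8 : ℝ) / k ≤ 0.01 := by
    rw [div_le_iff₀ (by positivity)]
    linarith [show (1000 : ℝ) ≤ k by exact_mod_cast hk]
  refine le_real_sketch_of_bad_events
    (real_le_lambdaMin_bilinearSketch_le (by omega) hA hε hε₁ hfar) htr hfr (by linarith)
    fun X hlambda htrace hfrob accepts => ?_
  exact (lt_gammaStat (by omega) hkε (frobNorm_pos hfar.1) (not_lt.1 htrace) (not_not.1 hfrob)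
    (not_le.1 hlambda)).not_ge accepts.2

end Correctness

theorem sketchTester_isL2Tester (hk : 1000 ≤ k) (trEst_measurable : Measurable trEst)
    (frEst_measurable : Measurable frEst)
    (htr : ∀ A : Matrix (Fin d) (Fin d) ℝ, A.IsHermitian → (gaussianMatrix d (Fin m)).real
      {H | frobNorm A < |trEst (bilinearSketch A H) - A.trace|} ≤ 0.01)
    (hfr : ∀ A : Matrix (Fin d) (Fin d) ℝ, (gaussianMatrix d (Fin m)).real
      {H | ¬(frobNorm A / 2 ≤ frEst (bilinearSketch A H) ∧
        frEst (bilinearSketch A H) ≤ 2 * frobNorm A)} ≤ 0.01)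
    {ε : ℝ} (hε : 0 < ε) (hε₁ : ε < 1) (hkε : 330 * (Real.sqrt k * Real.log k) < ε * k) :
    (sketchTester d k m trEst frEst 74).IsL2Tester ε 0.9 := by
  intro A hA
  replace hA : A.IsHermitian := Matrix.isHermitian_iff_isSymm.2 hA
  rw [sketchTester_outputsTrue]
  exact ⟨measurableSet_sketchAccepts (by omega) trEst_measurable frEst_measurable 74 hA,
    le_real_sketchAccepts_of_posSemidef (htr A hA) (hfr A) (by omega),
    le_real_not_sketchAccepts_of_isFarFromPSD (htr A hA) (hfr A) hk hA hε hε₁ hkε⟩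

end Tester

section Parameters

/-- The number of columns of `G` in the tester with parameter `ε`. The constant `2 ^ 28` makes
`ε * √(sketchSize ε)` dominate a fixed multiple of `log (sketchSize ε)`. -/
noncomputable def sketchSize (ε : ℝ) : ℕ :=
  ⌈(2 : ℝ) ^ 28 * ((1 / ε ^ 2) * Real.log (2 / ε) ^ 2)⌉₊

variable {ε : ℝ} (hε : 0 < ε) (hε₁ : ε < 1)

include hε hε₁

theorem log_two_le_log_two_div : Real.log 2 ≤ Real.log (2 / ε) :=
  Real.log_le_log (by norm_num) ((le_div_iff₀ hε).2 (by linarith))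

theorem quarter_lt_inv_sq_mul_log_sq : 1 / 4 < (1 / ε ^ 2) * Real.log (2 / ε) ^ 2 := by
  have hL : 1 / 2 < Real.log (2 / ε) := by
    linarith [log_two_le_log_two_div hε hε₁, Real.log_two_gt_d9]
  calc (1 / 4 : ℝ) = 1 * (1 / 2) ^ 2 := by norm_num
    _ < 1 * Real.log (2 / ε) ^ 2 := by gcongr
    _ ≤ (1 / ε ^ 2) * Real.log (2 / ε) ^ 2 := by
      gcongr
      exact (one_le_div (by positivity)).2 (pow_le_one₀ hε.le hε₁.le)

theorem thousand_le_sketchSize : 1000 ≤ sketchSize ε := by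
  have size_large : (1000 : ℝ) ≤ sketchSize ε :=
    le_trans (by linarith [quarter_lt_inv_sq_mul_log_sq hε hε₁]) (Nat.le_ceil _)
  exact_mod_cast size_large

theorem sketchSize_add_le :
    ((sketchSize ε + 3200 : ℕ) : ℝ) ≤ 2 ^ 29 * ((1 / ε ^ 2) * Real.log (2 / ε) ^ 2) := by
  have ceil_lt : (sketchSize ε : ℝ) < 2 ^ 28 * ((1 / ε ^ 2) * Real.log (2 / ε) ^ 2) + 1 :=
    Nat.ceil_lt_add_one (by positivity)
  push_cast
  linarith [quarter_lt_inv_sq_mul_log_sq hε hε₁]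

theorem log_sketchSize_le : Real.log (sketchSize ε) ≤ 33 * Real.log (2 / ε) := by
  have size_pos : (0 : ℝ) < sketchSize ε := by
    exact_mod_cast (by norm_num : 0 < 1000).trans_le (thousand_le_sketchSize hε hε₁)
  have two_le : 2 ≤ 2 / ε := (le_div_iff₀ hε).2 (by linarith)
  have log_nonneg : 0 ≤ Real.log (2 / ε) := Real.log_nonneg (by linarith)
  have size_le : (sketchSize ε : ℝ) ≤ (2 / ε) ^ 33 :=
    calc (sketchSize ε : ℝ) ≤ 2 ^ 29 * ((1 / ε) ^ 2 * Real.log (2 / ε) ^ 2) := by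
          rw [one_div_pow]
          exact le_trans (by norm_num) (sketchSize_add_le hε hε₁)
      _ ≤ (2 / ε) ^ 29 * ((2 / ε) ^ 2 * (2 / ε) ^ 2) := by
          gcongr
          · norm_num
          · exact Real.log_le_self (by positivity)
      _ = (2 / ε) ^ 33 := by ring
  calc Real.log (sketchSize ε) ≤ Real.log ((2 / ε) ^ 33) := Real.log_le_log size_pos size_le
    _ = 33 * Real.log (2 / ε) := by rw [Real.log_pow]; norm_num

theorem sqrt_mul_log_sketchSize_lt :
    330 * (Real.sqrt (sketchSize ε) * Real.log (sketchSize ε)) < ε * sketchSize ε := by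
  have log_pos : 0 < Real.log (2 / ε) := (Real.log_pos one_lt_two).trans_le
    (log_two_le_log_two_div hε hε₁)
  have sqrt_pos : 0 < Real.sqrt (sketchSize ε) := Real.sqrt_pos.2 <| by
    exact_mod_cast (by norm_num : 0 < 1000).trans_le (thousand_le_sketchSize hε hε₁)
  have le_sqrt : 2 ^ 14 * Real.log (2 / ε) / ε ≤ Real.sqrt (sketchSize ε) := by
    refine Real.le_sqrt_of_sq_le ((le_of_eq ?_).trans (Nat.le_ceil _))
    field_simp
  calc 330 * (Real.sqrt (sketchSize ε) * Real.log (sketchSize ε))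
    _ ≤ 330 * (Real.sqrt (sketchSize ε) * (33 * Real.log (2 / ε))) := by
        gcongr
        exact log_sketchSize_le hε hε₁
    _ < Real.sqrt (sketchSize ε) * (2 ^ 14 * Real.log (2 / ε)) := by
        linarith [mul_pos sqrt_pos log_pos]
    _ ≤ Real.sqrt (sketchSize ε) * (Real.sqrt (sketchSize ε) * ε) :=
        mul_le_mul_of_nonneg_left ((div_le_iff₀ hε).1 le_sqrt) sqrt_pos.le
    _ = ε * sketchSize ε := by rw [← mul_assoc, Real.mul_self_sqrt (Nat.cast_nonneg _), mul_comm]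

end Parameters

theorem numQueries_sketchTester (d k m : ℕ) (trEst frEst : Matrix (Fin m) (Fin m) ℝ → ℝ) (c : ℝ) :
    (sketchTester d k m trEst frEst c).numQueries = (k + m) ^ 2 := by
  rw [NonadaptiveVMV.numQueries, Fintype.card_prod, Fintype.card_sum, Fintype.card_fin,
    Fintype.card_fin, sq]

end PSDTesting

open PSDTesting in
theorem mainTheorem3 :
    ∃ (m : ℕ) (trEst frEst : Matrix (Fin m) (Fin m) ℝ → ℝ) (cpsd C : ℝ),
      0 < cpsd ∧ 0 < C ∧ Measurable trEst ∧ Measurable frEst ∧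
      (∀ (d : ℕ) (A : Matrix (Fin d) (Fin d) ℝ), A.IsSymm →
        0.99 ≤ (gaussianMatrix d (Fin m)).real
          {H | |trEst (bilinearSketch A H) - A.trace| ≤ frobNorm A} ∧
        0.99 ≤ (gaussianMatrix d (Fin m)).real
          {H | frobNorm A / 2 ≤ frEst (bilinearSketch A H) ∧
            frEst (bilinearSketch A H) ≤ 2 * frobNorm A}) ∧
      ∀ ε : ℝ, 0 < ε → ε < 1 →
        ∃ k : ℕ, 0 < k ∧
          ((k + m : ℕ) : ℝ) ≤ C * (1 / ε ^ 2) * Real.log (2 / ε) ^ 2 ∧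
          ∀ d : ℕ,
            (sketchTester d k m trEst frEst cpsd).IsL2Tester ε 0.9 ∧
            ((sketchTester d k m trEst frEst cpsd).numQueries : ℝ) ≤
              C * (1 / ε ^ 4) * Real.log (2 / ε) ^ 4 := by
  have trace_deviation (d : ℕ) (A : Matrix (Fin d) (Fin d) ℝ) (hA : A.IsHermitian) :=
    (real_traceEstimate_deviation_le (m := 1600 + 1600) (by norm_num) hA).trans
      (by norm_num : _ ≤ (0.01 : ℝ))
  have frob_deviation (d : ℕ) (A : Matrix (Fin d) (Fin d) ℝ) :=
    (real_frobEstimate_deviation_le (n := 1600) (by norm_num) A).trans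
      (by norm_num : _ ≤ (0.01 : ℝ))
  refine ⟨1600 + 1600, traceEstimate _, frobEstimate 1600, 74, (2 ^ 29) ^ 2, by norm_num,
    by norm_num, measurable_traceEstimate _, measurable_frobEstimate _, fun d A hA => ⟨?_, ?_⟩,
    fun ε hε hε₁ => ⟨sketchSize ε, (Nat.succ_pos 999).trans_le (thousand_le_sketchSize hε hε₁), ?_,
      fun d => ⟨?_, ?_⟩⟩⟩
  · exact le_measureReal_of_notMem (trace_deviation d A (Matrix.isHermitian_iff_isSymm.2 hA))
      (by norm_num) fun H hH => by simpa only [Set.mem_ofPred_eq, not_lt] using hH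
  · exact le_measureReal_of_notMem (frob_deviation d A) (by norm_num) fun H hH => not_not.1 hH
  · refine (sketchSize_add_le hε hε₁).trans ?_
    rw [mul_assoc]
    gcongr
    norm_num
  · exact sketchTester_isL2Tester (thousand_le_sketchSize hε hε₁) (measurable_traceEstimate _)
      (measurable_frobEstimate _) (trace_deviation d) (frob_deviation d) hε hε₁
      (sqrt_mul_log_sketchSize_lt hε hε₁)
  · rw [numQueries_sketchTester, Nat.cast_pow]
    calc _ ≤ (2 ^ 29 * ((1 / ε ^ 2) * Real.log (2 / ε) ^ 2)) ^ 2 := by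
          gcongr
          exact sketchSize_add_le hε hε₁
      _ = _ := by field_simp
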